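/- **Setting.** Let $\mathbf k\subseteq\mathbb C$ be a field and $\lambda\in\mathbf k$. Let $X$ be a Hoffman set: a disjoint union of finite sets $X_n$, $n\ge 1$ (elements of $X_n$ have degree $n$), with a pairing $[\cdot,\cdot]$ on $X\cup\{0\}$ that is commutative and associative, satisfies $[a,0]=0$ for all $a$, and is either identically zero or satisfies $\deg[a,b]=\deg a+\deg b$ for all letters $a,b\in X$ (in the second case this is required here only when $[a,b]\neq 0$). Let $A=\mathbf k\{X\}$ be the free $\mathbf k$-module on $X$ with the product extending $[\cdot,\cdot]$ bilinearly, and let $\tilde A=\mathbf k\oplus A$ be its unitization, with identity $\mathbf 1_A$. For a commutative $\mathbf k$-algebra $B$, not necessarily unital, let $\mathrm{Sh}^+(B)=\bigoplus_{n\ge0}B^{\otimes n}$ (often denoted by the Cyrillic letter Sha) with the mixable shuffle product of weight $\lambda$: for $a=a_1\otimes\cdots\otimes a_m$ and $b=b_1\otimes\cdots\otimes b_n$, $$a\diamond^+b=\sum_{(\sigma,T)}\lambda^{|T|}\,\sigma(a\otimes b;T),$$ where $\sigma$ runs over the permutations of $\{1,\dots,m+n\}$ for which $\sigma^{-1}$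 is increasing on $\{1,\dots,m\}$ and on $\{m+1,\dots,m+n\}$, $T$ runs over the sets of pairs $(i,i+1)$, $1\le i<m+n$, with $\sigma(i)\le m<\sigma(i+1)$, and $\sigma(a\otimes b;T)$ is $u_{\sigma(1)}\otimes\cdots\otimes u_{\sigma(m+n)}$, $u=(a_1,\dots,a_m,b_1,\dots,b_n)$, with $u_{\sigma(i)}\otimes u_{\sigma(i+1)}$ replaced by the product $u_{\sigma(i)}u_{\sigma(i+1)}$ for each $(i,i+1)\in T$. This makes $\mathrm{Sh}^+(B)$ a commutative $\mathbf k$-algebra with identity $1\in B^{\otimes 0}=\mathbf k$. Let $\gamma^+:\mathrm{Sh}^+(\mathbf k)\to \mathrm{Sh}^+(\tilde A)$, $\mathbf 1_{\mathbf k}^{\otimes n}\mapsto\mathbf 1_A^{\otimes n}$, and $\beta:\mathrm{Sh}^+(A)\to \mathrm{Sh}^+(\tilde A)$ be the map induced by $A\subseteq\tilde A$. For a word $w=w_1\cdots w_r$ ($r\ge0$) in the alphabet $\tilde X=\{\mathbf 1_A\}\cup X$ put $y_{\otimes w}=w_1\otimes\cdots\otimes w_r\in \mathrm{Sh}^+(\tilde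 A)$. The one-shuffled element $O(y_{\otimes w})$ is the sum of $y_{\otimes v}$ over all words $v$ in $\tilde X$ of the same length as $w$ such that deleting the letters $\mathbf 1_A$ from $v$ and from $w$ leaves the same word in $X$. Let $V\subseteq \mathrm{Sh}^+(\tilde A)$ be the $\mathbf k$-span of all one-shuffled elements. **Theorem.** (a) $V$ is a unital subalgebra of $(\mathrm{Sh}^+(\tilde A),\diamond^+)$; it is the product $\gamma^+(\mathrm{Sh}^+(\mathbf k))\diamond^+\beta(\mathrm{Sh}^+(A))$, that is, the span of the products of elements of the two images. (b) $\mathrm{Sh}^+(\mathbf k)$ is a Hopf algebra whose comultiplication and counit are, with $a_n=\mathbf 1_{\mathbf k}^{\otimes n}$, $$\Delta(a_n)=\sum_{i+j+l=n}(-\lambda)^j\,a_i\otimes a_l,\qquad \varepsilon(a_0)=1,\quad \varepsilon(a_1)=\lambda,\quad \varepsilon(a_n)=0\ (n\ge2),$$ and $\mathrm{Sh}^+(A)$ is a Hopf algebra whose comultiplication and counit are given on words in letters $x_1,\dots,x_n\in X$ by $$\Delta(x_1\otimes\cdots\otimes x_n)=\sum_{i=0}^n(x_1\otimes\cdots\otimes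 x_i)\otimes(x_{i+1}\otimes\cdots\otimes x_n),\qquad \varepsilon(x_1\otimes\cdots\otimes x_n)=\delta_{n,0}.$$ (c) The algebra $V$ has a Hopf algebra structure that contains these two Hopf algebras: $\gamma^+$ and $\beta$ are injective algebra homomorphisms into $V$, and they are homomorphisms of Hopf algebras (compatible with comultiplications, counits and antipodes). -/

import Mathlib

open scoped TensorProduct DirectSum

set_option linter.unusedSectionVars false

noncomputable section

namespace MixableShuffle

section Product

variable {k : Type*} [CommRing k] {A : Type*} [NonUnitalCommRing A] [Module k A]
  [IsScalarTower k A A] [SMulCommClass k A A]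

open Classical in
/-- `shuffles N m` is the set `S(m, N - m)` of `(m, N - m)`-shuffles: the permutations `σ` of `N`
positions (counted from `0`) such that `σ⁻¹` is increasing on the first `m` indices and increasing
on the remaining `N - m` indices. For two words of lengths `m` and `n` it is used with
`N = m + n`. -/
def shuffles (N m : ℕ) : Finset (Equiv.Perm (Fin N)) :=
  {σ | ∀ i j : Fin N, i < j → ((j : ℕ) < m ∨ m ≤ (i : ℕ)) → σ.symm i < σ.symm j}

open Classical in
/-- The set of admissible pairs `(i, i + 1)` of positions of a shuffle `σ`, recorded by `i`: those
for which `σ i` is an index of the first word and `σ (i + 1)` an index of the second word. -/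
def admissible (N m : ℕ) (σ : Equiv.Perm (Fin N)) : Finset ℕ :=
  {i ∈ Finset.range N | ∃ h : i + 1 < N,
    (σ ⟨i, Nat.lt_of_succ_lt h⟩ : ℕ) < m ∧ m ≤ (σ ⟨i + 1, h⟩ : ℕ)}

variable (k A) in
open Classical in
/-- `hatFrom n t a v` is the element `a ⊗̂ v 0 ⊗̂ ⋯ ⊗̂ v (n - 1)` of the tensor algebra (whose degree
`r` part is `A^{⊗ r}`), where the `i`-th junction `⊗̂` (from `0`) is the product of `A` if `t i`
holds, and is `⊗` otherwise. It is linear in each of its entries. -/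
def hatFrom : (n : ℕ) → (ℕ → Prop) →
    A →ₗ[k] MultilinearMap k (fun _ : Fin n => A) (TensorAlgebra k A)
  | 0, _ =>
    { toFun := fun a => MultilinearMap.constOfIsEmpty k _ (TensorAlgebra.ι k a)
      map_add' := fun a b => by ext; simp
      map_smul' := fun c a => by ext; simp }
  | n + 1, t =>
    { toFun := fun a => LinearMap.uncurryLeft
        (if t 0 then hatFrom n (fun i => t (i + 1)) ∘ₗ LinearMap.mulLeft k a
          else (LinearMap.mulLeft k (TensorAlgebra.ι k a)).compMultilinearMapₗ k ∘ₗ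
            hatFrom n (fun i => t (i + 1)))
      map_add' := fun a b => by ext v; by_cases h : t 0 <;> simp [h, add_mul]
      map_smul' := fun c a => by ext v; by_cases h : t 0 <;> simp [h, smul_mul_assoc] }

variable (k A) in
/-- `hatTensor N t v` is the element `v 0 ⊗̂ v 1 ⊗̂ ⋯ ⊗̂ v (N - 1)`, where `v i ⊗̂ v (i + 1)` is
`v i * v (i + 1)` if `t i` holds and `v i ⊗ v (i + 1)` otherwise; it is `1` if `N = 0`. -/
def hatTensor : (N : ℕ) → (ℕ → Prop) →
    MultilinearMap k (fun _ : Fin N => A) (TensorAlgebra k A)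
  | 0, _ => MultilinearMap.constOfIsEmpty k _ 1
  | n + 1, t => (hatFrom k A n t).uncurryLeft

variable (k A) in
/-- The sum over all mixable shuffles `(σ, T)`, `σ ∈ S(m, N - m)`, `T` a set of admissible pairs
of `σ`, of `λ ^ |T|` times `u (σ 0) ⊗̂ ⋯ ⊗̂ u (σ (N - 1))`, the merged pairs being those of `T`; as a
multilinear map in `u`. -/
def mixMultilinear (lam : k) (N m : ℕ) :
    MultilinearMap k (fun _ : Fin N => A) (TensorAlgebra k A) :=
  ∑ σ ∈ shuffles N m, ∑ T ∈ (admissible N m σ).powerset,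
    lam ^ T.card • (hatTensor k A N (· ∈ T)).domDomCongr σ

variable (k A) in
/-- The mixable shuffle product of weight `λ` on `⨁ n, A^{⊗ n}`, identified with the tensor algebra
as a module; `mixProd_tprod` is its defining formula on pure tensors. -/
def mixProd (lam : k) :
    TensorAlgebra k A →ₗ[k] TensorAlgebra k A →ₗ[k] TensorAlgebra k A :=
  let P : (⨁ n, ⨂[k]^n A) →ₗ[k] (⨁ n, ⨂[k]^n A) →ₗ[k] TensorAlgebra k A :=
    DirectSum.toModule k ℕ _ fun m => LinearMap.flip <| DirectSum.toModule k ℕ _ fun n =>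
      ((TensorProduct.mk k (⨂[k]^m A) (⨂[k]^n A)).compr₂
        (PiTensorProduct.lift (mixMultilinear k A lam (m + n) m) ∘ₗ
          TensorPower.mulEquiv.toLinearMap)).flip
  P.compl₁₂ TensorAlgebra.equivDirectSum.toLinearMap TensorAlgebra.equivDirectSum.toLinearMap

/-- The mixable shuffle product of `a = a₁ ⊗ ⋯ ⊗ aₘ` and `b = b₁ ⊗ ⋯ ⊗ bₙ` is the sum of
`λ ^ |T| σ(a ⊗ b; T)` over all mixable `(m, n)`-shuffles `(σ, T)`. -/
theorem mixProd_tprod (lam : k) {m n : ℕ} (a : Fin m → A) (b : Fin n → A) :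
    mixProd k A lam (TensorAlgebra.tprod k A m a) (TensorAlgebra.tprod k A n b) =
      ∑ σ ∈ shuffles (m + n) m, ∑ T ∈ (admissible (m + n) m σ).powerset,
        lam ^ T.card • hatTensor k A (m + n) (· ∈ T) (fun i => Fin.append a b (σ i)) := by
  have h : ∀ (r : ℕ) (c : Fin r → A), TensorAlgebra.equivDirectSum (TensorAlgebra.tprod k A r c) =
      DirectSum.of (fun n => ⨂[k]^n A) r (PiTensorProduct.tprod k c) := fun r c =>
    TensorAlgebra.toDirectSum_tensorPower_tprod c
  simp only [mixProd, LinearMap.compl₁₂_apply, AlgEquiv.toLinearMap_apply, h]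
  have h2 := TensorPower.tprod_mul_tprod (R := k) a b
  rw [TensorPower.gMul_def] at h2
  erw [DirectSum.toModule_lof]
  rw [LinearMap.flip_apply]
  erw [DirectSum.toModule_lof]
  simp [h2, mixMultilinear]


/-- The permutation that sends `0` to `p` and is order-isomorphic to `e` on the other positions. -/
def consPerm {N : ℕ} (p : Fin (N + 1)) (e : Equiv.Perm (Fin N)) : Equiv.Perm (Fin (N + 1)) :=
  (finSuccEquiv' 0).trans ((Equiv.optionCongr e).trans (finSuccEquiv' p).symm)

theorem consPerm_zero {N : ℕ} (p : Fin (N + 1)) (e : Equiv.Perm (Fin N)) :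
    consPerm p e 0 = p := by simp [consPerm]

theorem consPerm_succ {N : ℕ} (p : Fin (N + 1)) (e : Equiv.Perm (Fin N)) (i : Fin N) :
    consPerm p e i.succ = p.succAbove (e i) := by
  have h : i.succ = Fin.succAbove 0 i := by simp
  rw [h]
  simp only [consPerm, Equiv.trans_apply, finSuccEquiv'_succAbove]
  simp

theorem consPerm_symm_self {N : ℕ} (p : Fin (N + 1)) (e : Equiv.Perm (Fin N)) :
    (consPerm p e).symm p = 0 := by
  rw [Equiv.symm_apply_eq, consPerm_zero]

theorem consPerm_symm_succAbove {N : ℕ} (p : Fin (N + 1)) (e : Equiv.Perm (Fin N)) (i : Fin N) :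
    (consPerm p e).symm (p.succAbove i) = (e.symm i).succ := by
  rw [Equiv.symm_apply_eq, consPerm_succ, Equiv.apply_symm_apply]

theorem sum_perm_succ {M : Type*} [AddCommMonoid M] {N : ℕ}
    (f : Equiv.Perm (Fin (N + 1)) → M) :
    ∑ σ, f σ = ∑ p : Fin (N + 1), ∑ e : Equiv.Perm (Fin N), f (consPerm p e) := by
  rw [← Fintype.sum_prod_type' (f := fun p e => f (consPerm p e))]
  symm
  apply Fintype.sum_bijective (fun x : Fin (N + 1) × Equiv.Perm (Fin N) => consPerm x.1 x.2)
    _ _ _ (fun x => rfl)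
  rw [Fintype.bijective_iff_injective_and_card]
  constructor
  · rintro ⟨p, e⟩ ⟨q, e'⟩ h
    have hp : p = q := by
      have := congrArg (fun s : Equiv.Perm (Fin (N + 1)) => s 0) h
      simpa [consPerm_zero] using this
    subst hp
    congr 1
    ext i
    have := congrArg (fun s : Equiv.Perm (Fin (N + 1)) => s i.succ) h
    simp only [consPerm_succ] at this
    rw [Fin.succAbove_right_injective this]
  · simp [Fintype.card_perm, Nat.factorial_succ]

theorem mem_shuffles {N m : ℕ} {σ : Equiv.Perm (Fin N)} : σ ∈ shuffles N m ↔
    ∀ i j : Fin N, i < j → ((j : ℕ) < m ∨ m ≤ (i : ℕ)) → σ.symm i < σ.symm j := by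
  simp [shuffles]

theorem mem_shuffles_consPerm_iff {N m : ℕ} (p : Fin (N + 1)) (e : Equiv.Perm (Fin N)) :
    consPerm p e ∈ shuffles (N + 1) m ↔
      (∀ i : Fin (N + 1), i < p → (i : ℕ) < m ∧ m ≤ (p : ℕ)) ∧
      (∀ i j : Fin N, i < j → ((p.succAbove j : ℕ) < m ∨ m ≤ (p.succAbove i : ℕ)) →
        e.symm i < e.symm j) := by
  rw [mem_shuffles]
  constructor
  · intro h
    constructor
    · intro i hi
      have h1 := h i p hi
      rw [consPerm_symm_self] at h1
      by_contra hc
      have h2 := h1 (by omega)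
      exact absurd h2 (by simp)
    · intro i j hij hm
      have h1 := h _ _ (p.strictMono_succAbove hij) hm
      rwa [consPerm_symm_succAbove, consPerm_symm_succAbove, Fin.succ_lt_succ_iff] at h1
  · rintro ⟨h1, h2⟩ i j hij hm
    rcases eq_or_ne i p with rfl | hi
    · obtain ⟨j, rfl⟩ := Fin.exists_succAbove_eq hij.ne'
      rw [consPerm_symm_self, consPerm_symm_succAbove]
      exact Fin.succ_pos _
    rcases eq_or_ne j p with rfl | hj
    · have := h1 i hij
      omega
    obtain ⟨i, rfl⟩ := Fin.exists_succAbove_eq hi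
    obtain ⟨j, rfl⟩ := Fin.exists_succAbove_eq hj
    rw [consPerm_symm_succAbove, consPerm_symm_succAbove, Fin.succ_lt_succ_iff]
    exact h2 i j (p.strictMono_succAbove.lt_iff_lt.1 hij) hm

theorem val_succAbove {N : ℕ} (p : Fin (N + 1)) (i : Fin N) :
    (p.succAbove i : ℕ) = if (i : ℕ) < p then (i : ℕ) else i + 1 := by
  unfold Fin.succAbove
  split_ifs <;> simp_all [Fin.lt_def]

theorem consPerm_mem_left {N m : ℕ} (e : Equiv.Perm (Fin N)) :
    consPerm 0 e ∈ shuffles (N + 1) (m + 1) ↔ e ∈ shuffles N m := by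
  rw [mem_shuffles_consPerm_iff, mem_shuffles]
  simp

theorem consPerm_mem_right {N m : ℕ} (p : Fin (N + 1)) (e : Equiv.Perm (Fin N))
    (hp : m ≤ p) :
    consPerm p e ∈ shuffles (N + 1) m ↔ (p : ℕ) = m ∧ e ∈ shuffles N m := by
  rw [mem_shuffles_consPerm_iff, mem_shuffles]
  constructor
  · rintro ⟨h1, h2⟩
    have hpm : (p : ℕ) = m := by
      by_contra hc
      have := h1 ⟨m, by omega⟩ (by rw [Fin.lt_def]; simp; omega)
      simp at this
    refine ⟨hpm, fun i j hij hm => h2 i j hij ?_⟩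
    simp only [val_succAbove, hpm]
    rw [Fin.lt_def] at hij
    split_ifs <;> omega
  · rintro ⟨hpm, h⟩
    refine ⟨fun i hi => ⟨by rw [Fin.lt_def] at hi; omega, hp⟩, fun i j hij hm => h i j hij ?_⟩
    simp only [val_succAbove, hpm] at hm
    rw [Fin.lt_def] at hij
    split_ifs at hm <;> omega

theorem consPerm_not_mem {N m : ℕ} (p : Fin (N + 1)) (e : Equiv.Perm (Fin N))
    (h0 : 0 < (p : ℕ)) (hp : (p : ℕ) < m) : consPerm p e ∉ shuffles (N + 1) m := by
  rw [mem_shuffles_consPerm_iff]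
  rintro ⟨h1, -⟩
  have := h1 0 (by rw [Fin.lt_def]; simpa using h0)
  omega

theorem sum_shuffles_right {M : Type*} [AddCommMonoid M] {N m : ℕ} (hm : m < N + 1)
    (f : Equiv.Perm (Fin (N + 1)) → M) :
    ∑ σ ∈ shuffles (N + 1) m with m ≤ (σ 0 : ℕ), f σ =
      ∑ e ∈ shuffles N m, f (consPerm ⟨m, hm⟩ e) := by
  classical
  have h1 : ∑ σ ∈ shuffles (N + 1) m with m ≤ (σ 0 : ℕ), f σ =
      ∑ σ, if σ ∈ shuffles (N + 1) m ∧ m ≤ (σ 0 : ℕ) then f σ else 0 := by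
    rw [← Finset.sum_filter]
    congr 1
    ext; simp
  rw [h1, sum_perm_succ, Finset.sum_eq_single ⟨m, hm⟩]
  · rw [← Finset.sum_filter]
    congr 1
    ext e
    simp [consPerm_zero, consPerm_mem_right]
  · intro p _ hp
    apply Finset.sum_eq_zero
    intro e _
    rw [if_neg]
    rintro ⟨h2, h3⟩
    rw [consPerm_zero] at h3
    rw [consPerm_mem_right p e h3] at h2
    exact hp (Fin.ext h2.1)
  · simp

theorem sum_shuffles_left {M : Type*} [AddCommMonoid M] {N m : ℕ}
    (f : Equiv.Perm (Fin (N + 1)) → M) :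
    ∑ σ ∈ shuffles (N + 1) (m + 1) with ¬ m + 1 ≤ (σ 0 : ℕ), f σ =
      ∑ e ∈ shuffles N m, f (consPerm 0 e) := by
  classical
  have h1 : ∑ σ ∈ shuffles (N + 1) (m + 1) with ¬ m + 1 ≤ (σ 0 : ℕ), f σ =
      ∑ σ, if σ ∈ shuffles (N + 1) (m + 1) ∧ ¬ m + 1 ≤ (σ 0 : ℕ) then f σ else 0 := by
    rw [← Finset.sum_filter]
    congr 1
    ext; simp
  rw [h1, sum_perm_succ, Finset.sum_eq_single 0]
  · rw [← Finset.sum_filter]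
    congr 1
    ext e
    simp [consPerm_zero, consPerm_mem_left]
  · intro p _ hp
    apply Finset.sum_eq_zero
    intro e _
    rw [if_neg]
    rintro ⟨h2, h3⟩
    rw [consPerm_zero] at h3
    refine consPerm_not_mem p e ?_ (not_le.1 h3) h2
    exact Nat.pos_of_ne_zero fun h => hp (Fin.ext h)
  · simp

theorem mem_admissible {N m : ℕ} {σ : Equiv.Perm (Fin N)} {i : ℕ} :
    i ∈ admissible N m σ ↔ ∃ h : i + 1 < N,
      (σ ⟨i, Nat.lt_of_succ_lt h⟩ : ℕ) < m ∧ m ≤ (σ ⟨i + 1, h⟩ : ℕ) := by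
  simp only [admissible, Finset.mem_filter, Finset.mem_range, and_iff_right_iff_imp]
  rintro ⟨h, -⟩
  omega

theorem consPerm_mk_succ {N : ℕ} (p : Fin (N + 1)) (e : Equiv.Perm (Fin N)) (i : ℕ)
    (h : i + 1 < N + 1) :
    consPerm p e ⟨i + 1, h⟩ = p.succAbove (e ⟨i, Nat.lt_of_succ_lt_succ h⟩) :=
  consPerm_succ p e ⟨i, Nat.lt_of_succ_lt_succ h⟩

theorem succ_mem_admissible_left {N m : ℕ} (e : Equiv.Perm (Fin N)) (i : ℕ) :
    i + 1 ∈ admissible (N + 1) (m + 1) (consPerm 0 e) ↔ i ∈ admissible N m e := by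
  simp only [mem_admissible, consPerm_mk_succ, val_succAbove]
  simp

theorem succ_mem_admissible_right {N m : ℕ} (hm : m < N + 1) (e : Equiv.Perm (Fin N)) (i : ℕ) :
    i + 1 ∈ admissible (N + 1) m (consPerm ⟨m, hm⟩ e) ↔ i ∈ admissible N m e := by
  simp only [mem_admissible, consPerm_mk_succ, val_succAbove]
  constructor <;> rintro ⟨h, h1, h2⟩ <;> refine ⟨by omega, ?_, ?_⟩ <;> split_ifs at * <;> omega

theorem zero_mem_admissible_left {N m : ℕ} (e : Equiv.Perm (Fin (N + 1))) :
    0 ∈ admissible (N + 2) (m + 1) (consPerm 0 e) ↔ m ≤ (e 0 : ℕ) := by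
  simp only [mem_admissible, consPerm_mk_succ, val_succAbove]
  simp [consPerm_zero]

theorem zero_not_mem_admissible_right {N m : ℕ} (hm : m < N + 1) (e : Equiv.Perm (Fin N)) :
    0 ∉ admissible (N + 1) m (consPerm ⟨m, hm⟩ e) := by
  simp [mem_admissible, consPerm_zero]

variable (k) in
/-- The contribution of one shuffle `σ` to the mixable shuffle product, with `v = u ∘ σ` and `P`
the set of admissible pairs. -/
def mixSum (lam : k) (N : ℕ) (P : Finset ℕ) (v : Fin N → A) : TensorAlgebra k A :=
  ∑ T ∈ P.powerset, lam ^ T.card • hatTensor k A N (· ∈ T) v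

theorem hatTensor_of_not {N : ℕ} (t : ℕ → Prop) (h : ¬ t 0) (v : Fin (N + 1) → A) :
    hatTensor k A (N + 1) t v =
      TensorAlgebra.ι k (v 0) * hatTensor k A N (fun i => t (i + 1)) (Fin.tail v) := by
  cases N with
  | zero => simp [hatTensor, hatFrom]
  | succ n => simp [hatTensor, hatFrom, h]

theorem hatTensor_of_mem {N : ℕ} (t : ℕ → Prop) (h : t 0) (h1 : ¬ t 1) (v : Fin (N + 2) → A) :
    hatTensor k A (N + 2) t v = TensorAlgebra.ι k (v 0 * v 1) *
      hatTensor k A N (fun i => t (i + 2)) (Fin.tail (Fin.tail v)) := by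
  cases N with
  | zero => simp [hatTensor, hatFrom, h]; rfl
  | succ n => simp [hatTensor, hatFrom, h, h1]; rfl

/-- The set `P - 1` of predecessors of the positive elements of `P`. -/
def shift (P : Finset ℕ) : Finset ℕ := (P.erase 0).image Nat.pred

theorem mem_shift {P : Finset ℕ} {i : ℕ} : i ∈ shift P ↔ i + 1 ∈ P := by
  simp only [shift, Finset.mem_image, Finset.mem_erase]
  constructor
  · rintro ⟨j, ⟨h0, hj⟩, rfl⟩
    rwa [Nat.pred_eq_sub_one, Nat.sub_add_cancel (Nat.pos_of_ne_zero h0)]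
  · exact fun h => ⟨i + 1, ⟨by omega, h⟩, rfl⟩

/-- The set `T + 1`. -/
def addOne (T : Finset ℕ) : Finset ℕ := T.map ⟨Nat.succ, Nat.succ_injective⟩

@[simp] theorem zero_notMem_addOne (T : Finset ℕ) : 0 ∉ addOne T := by simp [addOne]

@[simp] theorem succ_mem_addOne {T : Finset ℕ} {i : ℕ} : i + 1 ∈ addOne T ↔ i ∈ T := by
  simp [addOne]

@[simp] theorem card_addOne (T : Finset ℕ) : (addOne T).card = T.card := by simp [addOne]

theorem sum_powerset_succ {M : Type*} [AddCommMonoid M] (P : Finset ℕ) (h : 0 ∉ P)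
    (f : Finset ℕ → M) :
    ∑ T ∈ P.powerset, f T = ∑ T ∈ (shift P).powerset, f (addOne T) := by
  symm
  refine Finset.sum_bij (fun T _ => addOne T) ?_ ?_ ?_ (fun _ _ => rfl)
  · intro T hT
    rw [Finset.mem_powerset] at *
    intro i hi
    obtain ⟨j, hj, rfl⟩ := Finset.mem_map.1 hi
    exact mem_shift.1 (hT hj)
  · intro T _ T' _ h
    exact Finset.map_injective _ h
  · intro T hT
    rw [Finset.mem_powerset] at hT
    refine ⟨shift T, ?_, ?_⟩
    · rw [Finset.mem_powerset]
      intro i hi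
      exact mem_shift.2 (hT (mem_shift.1 hi))
    · ext i
      cases i with
      | zero => simp; exact fun h0 => h (hT h0)
      | succ i => simp [mem_shift]

theorem mixSum_of_not_mem (lam : k) {N : ℕ} (P : Finset ℕ) (h : 0 ∉ P) (v : Fin (N + 1) → A) :
    mixSum k lam (N + 1) P v =
      TensorAlgebra.ι k (v 0) * mixSum k lam N (shift P) (Fin.tail v) := by
  rw [mixSum, sum_powerset_succ P h, mixSum, Finset.mul_sum]
  refine Finset.sum_congr rfl fun T _ => ?_
  rw [hatTensor_of_not _ (by simp)]
  simp

theorem mixSum_of_mem (lam : k) {N : ℕ} (P : Finset ℕ) (h : 0 ∈ P) (h1 : 1 ∉ P)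
    (v : Fin (N + 2) → A) :
    mixSum k lam (N + 2) P v =
      TensorAlgebra.ι k (v 0) * mixSum k lam (N + 1) (shift P) (Fin.tail v) +
      lam • (TensorAlgebra.ι k (v 0 * v 1) *
        mixSum k lam N (shift (shift P)) (Fin.tail (Fin.tail v))) := by
  have hP : P = insert 0 (P.erase 0) := (Finset.insert_erase h).symm
  have hs : shift (P.erase 0) = shift P := by ext; simp [mem_shift]
  have hss : 0 ∉ shift P := by rwa [mem_shift]
  have h0 : 0 ∉ P.erase 0 := by simp
  rw [mixSum, hP, Finset.sum_powerset_insert h0, ← hP]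
  congr 1
  · rw [← hs, ← mixSum_of_not_mem lam _ h0]
    rfl
  · rw [sum_powerset_succ _ h0, hs, sum_powerset_succ _ hss, mixSum, Finset.mul_sum,
      Finset.smul_sum]
    refine Finset.sum_congr rfl fun T _ => ?_
    rw [hatTensor_of_mem _ (by simp) (by rw [← zero_add 1]; simp), Finset.card_insert_of_notMem (by simp)]
    simp [pow_succ', mul_smul]

variable (k) in
/-- The mixable shuffle product, before splitting the letters into two words. -/
def mixF (lam : k) (N m : ℕ) (u : Fin N → A) : TensorAlgebra k A :=
  ∑ σ ∈ shuffles N m, mixSum k lam N (admissible N m σ) (fun i => u (σ i))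

theorem mixF_congr (lam : k) {N N' : ℕ} (h : N = N') (m : ℕ) (u : Fin N → A) (u' : Fin N' → A)
    (hu : ∀ i, u i = u' (Fin.cast h i)) : mixF k lam N m u = mixF k lam N' m u' := by
  subst h
  congr 1
  ext i
  exact hu i

theorem mixSum_right (lam : k) {N m : ℕ} (hm : m < N + 1) (u : Fin (N + 1) → A)
    (e : Equiv.Perm (Fin N)) :
    mixSum k lam (N + 1) (admissible (N + 1) m (consPerm ⟨m, hm⟩ e))
      (fun i => u (consPerm ⟨m, hm⟩ e i)) = TensorAlgebra.ι k (u ⟨m, hm⟩) *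
      mixSum k lam N (admissible N m e) (fun i => u (Fin.succAbove ⟨m, hm⟩ (e i))) := by
  rw [mixSum_of_not_mem _ _ (zero_not_mem_admissible_right hm e), consPerm_zero]
  have hs : shift (admissible (N + 1) m (consPerm ⟨m, hm⟩ e)) = admissible N m e := by
    ext i; rw [mem_shift, succ_mem_admissible_right]
  rw [hs]
  simp only [Fin.tail_def, consPerm_succ]

theorem mixSum_left (lam : k) {N m : ℕ} (u : Fin (N + 2) → A)
    (e : Equiv.Perm (Fin (N + 1))) :
    mixSum k lam (N + 2) (admissible (N + 2) (m + 1) (consPerm 0 e))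
      (fun i => u (consPerm 0 e i)) = TensorAlgebra.ι k (u 0) *
      mixSum k lam (N + 1) (admissible (N + 1) m e) (fun i => u (e i).succ) +
      if m ≤ (e 0 : ℕ) then lam • (TensorAlgebra.ι k (u 0 * u (e 0).succ) *
        mixSum k lam N (shift (admissible (N + 1) m e)) (fun i => u (e i.succ).succ)) else 0 := by
  have hs : shift (admissible (N + 2) (m + 1) (consPerm 0 e)) = admissible (N + 1) m e := by
    ext i; rw [mem_shift, succ_mem_admissible_left]
  have h1 : consPerm 0 e 1 = (e 0).succ := by
    have := consPerm_succ 0 e 0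
    simpa using this
  by_cases h : m ≤ (e 0 : ℕ)
  · rw [if_pos h, mixSum_of_mem _ _ ((zero_mem_admissible_left e).2 h), hs, consPerm_zero, h1]
    · simp [Fin.tail_def, consPerm_succ]
    · intro h2
      have h2 := (succ_mem_admissible_left (m := m) e 0).1 h2
      rw [mem_admissible] at h2
      obtain ⟨_, h3, _⟩ := h2
      simp at h3
      omega
  · rw [if_neg h, mixSum_of_not_mem _ _ (fun h' => h ((zero_mem_admissible_left e).1 h')), hs,
      consPerm_zero, add_zero]
    simp [Fin.tail_def, consPerm_succ]

theorem mixF_rec (lam : k) {N m : ℕ} (hm : m < N + 1) (u : Fin (N + 2) → A) :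
    mixF k lam (N + 2) (m + 1) u =
      TensorAlgebra.ι k (u 0) * mixF k lam (N + 1) m (fun i => u i.succ) +
      TensorAlgebra.ι k (u ⟨m + 1, Nat.succ_lt_succ hm⟩) * mixF k lam (N + 1) (m + 1)
        (fun i => u (Fin.succAbove ⟨m + 1, Nat.succ_lt_succ hm⟩ i)) +
      lam • (TensorAlgebra.ι k (u 0 * u ⟨m + 1, Nat.succ_lt_succ hm⟩) *
        mixF k lam N m (fun i => u (Fin.succAbove ⟨m, hm⟩ i).succ)) := by
  rw [mixF, ← Finset.sum_filter_add_sum_filter_not _ (fun σ => m + 1 ≤ (σ 0 : ℕ)),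
    sum_shuffles_left, sum_shuffles_right (Nat.succ_lt_succ hm)]
  simp only [mixSum_right, mixSum_left, Finset.sum_add_distrib]
  rw [← Finset.sum_filter, sum_shuffles_right hm]
  have hs : ∀ e : Equiv.Perm (Fin N), shift (admissible (N + 1) m (consPerm ⟨m, hm⟩ e)) =
      admissible N m e := fun e => by ext i; rw [mem_shift, succ_mem_admissible_right]
  simp only [consPerm_zero, consPerm_succ, hs, mixF, Finset.mul_sum, Finset.smul_sum]
  rw [← add_assoc, add_comm (Finset.sum _ _) (Finset.sum _ _)]
  simp


theorem hatTensor_false (N : ℕ) (v : Fin N → A) :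
    hatTensor k A N (fun _ => False) v = TensorAlgebra.tprod k A N v := by
  induction N with
  | zero => simp [hatTensor]
  | succ n ih =>
    rw [hatTensor_of_not _ (by simp), ih]
    simp [List.ofFn_succ, Fin.tail_def]

theorem mixF_trivial (lam : k) {N m : ℕ} (h : m = 0 ∨ N ≤ m) (u : Fin N → A) :
    mixF k lam N m u = TensorAlgebra.tprod k A N u := by
  have hs : shuffles N m = {1} := by
    ext σ
    rw [mem_shuffles, Finset.mem_singleton]
    constructor
    · intro hσ
      have hmono : StrictMono σ.symm := fun i j hij => hσ i j hij (by omega)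
      have h2 : σ.symm = Equiv.refl _ := by
        ext i
        have := DFunLike.congr_fun (Subsingleton.elim
          (hmono.orderIsoOfSurjective σ.symm σ.symm.surjective) (OrderIso.refl (Fin N))) i
        exact congrArg Fin.val this
      rw [← Equiv.symm_symm σ, h2]
      rfl
    · rintro rfl i j hij -
      exact hij
  have ha : admissible N m 1 = ∅ := by
    ext i
    rw [mem_admissible]
    simp
    omega
  simp [mixF, hs, ha, mixSum, hatTensor_false]

variable (k) in
/-- The pure tensor `a₁ ⊗ ⋯ ⊗ aᵣ` of a list of elements of `A`. -/
def pureTensor (l : List A) : TensorAlgebra k A := (l.map (TensorAlgebra.ι k)).prod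

theorem pureTensor_nil : pureTensor k ([] : List A) = 1 := rfl

theorem pureTensor_cons (x : A) (l : List A) :
    pureTensor k (x :: l) = TensorAlgebra.ι k x * pureTensor k l := by
  simp [pureTensor]

theorem tprod_get (l : List A) :
    TensorAlgebra.tprod k A l.length l.get = pureTensor k l := by
  rw [TensorAlgebra.tprod_apply, pureTensor]
  congr 1
  conv_rhs => rw [← List.ofFn_get l, List.map_ofFn]
  rfl

theorem mixProd_pureTensor (lam : k) (a b : List A) :
    mixProd k A lam (pureTensor k a) (pureTensor k b) =
      mixF k lam (a ++ b).length a.length (a ++ b).get := by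
  rw [← tprod_get, ← tprod_get, mixProd_tprod]
  change mixF k lam (a.length + b.length) a.length (Fin.append a.get b.get) = _
  apply mixF_congr lam (by simp)
  intro i
  refine Fin.addCases (fun i => ?_) (fun i => ?_) i <;> simp

theorem mixProd_nil_left (lam : k) (b : List A) :
    mixProd k A lam 1 (pureTensor k b) = pureTensor k b := by
  rw [← pureTensor_nil, mixProd_pureTensor, mixF_trivial lam (by simp), tprod_get]
  rfl

theorem mixProd_nil_right (lam : k) (a : List A) :
    mixProd k A lam (pureTensor k a) 1 = pureTensor k a := by
  rw [← pureTensor_nil, mixProd_pureTensor, mixF_trivial lam (by simp), tprod_get]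
  simp

theorem mixProd_cons_cons (lam : k) (x y : A) (a b : List A) :
    mixProd k A lam (pureTensor k (x :: a)) (pureTensor k (y :: b)) =
      TensorAlgebra.ι k x * mixProd k A lam (pureTensor k a) (pureTensor k (y :: b)) +
      TensorAlgebra.ι k y * mixProd k A lam (pureTensor k (x :: a)) (pureTensor k b) +
      lam • (TensorAlgebra.ι k (x * y) * mixProd k A lam (pureTensor k a) (pureTensor k b)) := by
  simp only [mixProd_pureTensor]
  have hN : (x :: a ++ y :: b).length = (a ++ b).length + 2 := by simp; try omega
  have hm : a.length < (a ++ b).length + 1 := by simp; try omega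
  rw [mixF_congr lam hN (x :: a).length (x :: a ++ y :: b).get (fun i => (x :: a ++ y :: b).get (Fin.cast hN.symm i))
    (fun i => rfl), List.length_cons, mixF_rec lam hm]
  have hx : (x :: a ++ y :: b).get (Fin.cast hN.symm 0) = x := rfl
  have hy : (x :: a ++ y :: b).get
      (Fin.cast hN.symm ⟨a.length + 1, Nat.succ_lt_succ hm⟩) = y := by
    simp
  rw [hx, hy]
  congr 1
  · congr 1
    · congr 1
      exact mixF_congr lam (by simp; try omega) _ _ _ fun i => rfl
    · congr 1
      refine mixF_congr lam (by simp; try omega) _ _ _ ?_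
      rintro ⟨i, hi⟩
      simp only [List.get_eq_getElem, Fin.val_cast, val_succAbove, List.getElem_append,
        List.length_cons]
      split_ifs <;> first | omega | rfl | skip
      simp only [List.getElem_cons]
      split_ifs <;> first | omega | (congr 1; omega)
  · congr 2
    refine mixF_congr lam rfl _ _ _ ?_
    rintro ⟨i, hi⟩
    simp only [List.get_eq_getElem, Fin.val_cast, Fin.val_succ, val_succAbove,
      List.getElem_append, List.length_cons]
    split_ifs <;> first | omega | rfl | skip
    simp only [List.getElem_cons]
    split_ifs <;> first | omega | (congr 1; omega)

theorem span_pureTensor : Submodule.span k (Set.range (pureTensor k (A := A))) = ⊤ := by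
  have h := TensorAlgebra.adjoin_range_ι (R := k) (M := A)
  have h2 := congrArg Subalgebra.toSubmodule h
  rw [Algebra.adjoin_eq_span, Algebra.top_toSubmodule] at h2
  rw [← top_le_iff, ← h2]
  apply Submodule.span_mono
  intro x hx
  obtain ⟨l, hl, rfl⟩ := Submonoid.exists_list_of_mem_closure hx
  clear hx
  induction l with
  | nil => exact ⟨[], rfl⟩
  | cons y l ih =>
    obtain ⟨l', hl'⟩ := ih (fun z hz => hl z (List.mem_cons_of_mem _ hz))
    obtain ⟨z, hz⟩ := hl y List.mem_cons_self
    exact ⟨z :: l', by rw [pureTensor_cons, hl', hz, List.prod_cons]⟩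

theorem ext_pureTensor {M : Type*} [AddCommGroup M] [Module k M]
    {f g : TensorAlgebra k A →ₗ[k] M} (h : ∀ l, f (pureTensor k l) = g (pureTensor k l)) :
    f = g :=
  LinearMap.ext_on_range span_pureTensor h

theorem mixProd_one_left (lam : k) (x : TensorAlgebra k A) : mixProd k A lam 1 x = x := by
  have : mixProd k A lam 1 = LinearMap.id := ext_pureTensor (mixProd_nil_left lam)
  rw [this]; rfl

theorem mixProd_one_right (lam : k) (x : TensorAlgebra k A) : mixProd k A lam x 1 = x := by
  have : (mixProd k A lam).flip 1 = LinearMap.id := ext_pureTensor (mixProd_nil_right lam)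
  exact LinearMap.congr_fun this x

theorem mixProd_rec (lam : k) (x y : A) (X Y : TensorAlgebra k A) :
    mixProd k A lam (TensorAlgebra.ι k x * X) (TensorAlgebra.ι k y * Y) =
      TensorAlgebra.ι k x * mixProd k A lam X (TensorAlgebra.ι k y * Y) +
      TensorAlgebra.ι k y * mixProd k A lam (TensorAlgebra.ι k x * X) Y +
      lam • (TensorAlgebra.ι k (x * y) * mixProd k A lam X Y) := by
  let L := fun a : A => LinearMap.mulLeft k (TensorAlgebra.ι k a)
  have key : (mixProd k A lam).compl₁₂ (L x) (L y) =
      ((mixProd k A lam).compl₁₂ LinearMap.id (L y)).compr₂ (L x) +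
      ((mixProd k A lam).compl₁₂ (L x) LinearMap.id).compr₂ (L y) +
      lam • (mixProd k A lam).compr₂ (L (x * y)) := by
    refine ext_pureTensor fun a => ext_pureTensor fun b => ?_
    have := mixProd_cons_cons lam x y a b
    simp only [pureTensor_cons] at this
    simpa [L] using this
  have := LinearMap.congr_fun (LinearMap.congr_fun key X) Y
  simpa [L] using this

theorem mixProd_comm (lam : k) (X Y : TensorAlgebra k A) :
    mixProd k A lam X Y = mixProd k A lam Y X := by
  have key : mixProd k A lam = (mixProd k A lam).flip := by
    refine ext_pureTensor fun a => ext_pureTensor fun b => ?_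
    rw [LinearMap.flip_apply]
    induction a generalizing b with
    | nil => rw [pureTensor_nil, mixProd_one_left, mixProd_one_right]
    | cons x a iha =>
      induction b with
      | nil => rw [pureTensor_nil, mixProd_one_left, mixProd_one_right]
      | cons y b ihb =>
        rw [mixProd_cons_cons, mixProd_cons_cons, iha, iha, ihb, mul_comm y x]
        abel
  exact LinearMap.congr_fun (LinearMap.congr_fun key X) Y

theorem mixProd_assoc_pureTensor (lam : k) (n : ℕ) : ∀ a b c : List A,
    a.length + b.length + c.length ≤ n →
    mixProd k A lam (mixProd k A lam (pureTensor k a) (pureTensor k b)) (pureTensor k c) =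
      mixProd k A lam (pureTensor k a) (mixProd k A lam (pureTensor k b) (pureTensor k c)) := by
  induction n with
  | zero =>
    intro a b c h
    have ha : a = [] := List.length_eq_zero_iff.1 (by omega)
    rw [ha, pureTensor_nil, mixProd_one_left, mixProd_one_left]
  | succ n ih =>
    intro a b c h
    rcases a with _ | ⟨x, a⟩
    · rw [pureTensor_nil, mixProd_one_left, mixProd_one_left]
    rcases b with _ | ⟨y, b⟩
    · rw [pureTensor_nil, mixProd_one_left, mixProd_one_right]
    rcases c with _ | ⟨z, c⟩
    · rw [pureTensor_nil, mixProd_one_right, mixProd_one_right]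
    simp only [List.length_cons] at h
    have h1 := ih a (y :: b) (z :: c) (by simp; omega)
    have h2 := ih (x :: a) b (z :: c) (by simp; omega)
    have h3 := ih (x :: a) (y :: b) c (by simp; omega)
    have h4 := ih a b (z :: c) (by simp; omega)
    have h5 := ih a (y :: b) c (by simp; omega)
    have h6 := ih (x :: a) b c (by simp; omega)
    have h7 := ih a b c (by omega)
    simp only [pureTensor_cons] at h1 h2 h3 h4 h5 h6 h7 ⊢
    have hR := congrArg (fun w => mixProd k A lam w (pureTensor k c))
      (mixProd_rec lam x y (pureTensor k a) (pureTensor k b))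
    have hS := congrArg (fun w => mixProd k A lam (pureTensor k a) w)
      (mixProd_rec lam y z (pureTensor k b) (pureTensor k c))
    simp only [map_add, map_smul, LinearMap.add_apply, LinearMap.smul_apply] at hR hS
    rw [mixProd_rec lam x y, mixProd_rec lam y z]
    rw [h3] at hR
    rw [← h1] at hS
    simp only [map_add, map_smul, LinearMap.add_apply, LinearMap.smul_apply]
    generalize mixProd k A lam (pureTensor k a) (TensorAlgebra.ι k y * pureTensor k b) = U at *
    generalize mixProd k A lam (TensorAlgebra.ι k x * pureTensor k a) (pureTensor k b) = V at *
    generalize mixProd k A lam (pureTensor k a) (pureTensor k b) = W at *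
    generalize mixProd k A lam (pureTensor k b) (TensorAlgebra.ι k z * pureTensor k c) = U' at *
    generalize mixProd k A lam (TensorAlgebra.ι k y * pureTensor k b) (pureTensor k c) = V' at *
    generalize mixProd k A lam (pureTensor k b) (pureTensor k c) = W' at *
    simp only [mixProd_rec]
    rw [← h2, ← h4, hS, hR, ← h5, ← h6, ← h7, mul_assoc x y z]
    simp only [mul_add, mul_smul_comm, smul_add]
    abel

theorem mixProd_assoc (lam : k) (X Y Z : TensorAlgebra k A) :
    mixProd k A lam (mixProd k A lam X Y) Z = mixProd k A lam X (mixProd k A lam Y Z) := by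
  have key : (mixProd k A lam).compr₂ (mixProd k A lam) =
      (LinearMap.llcomp k _ _ _).flip (mixProd k A lam) ∘ₗ
        (LinearMap.llcomp k _ _ _ ∘ₗ mixProd k A lam) := by
    refine ext_pureTensor fun a => ext_pureTensor fun b => ext_pureTensor fun c => ?_
    exact mixProd_assoc_pureTensor lam _ a b c le_rfl
  exact LinearMap.congr_fun (LinearMap.congr_fun (LinearMap.congr_fun key X) Y) Z

end Product

theorem tensorAlgebra_basis_apply {k : Type*} [CommRing k] {A : Type*} [NonUnitalCommRing A]
    [Module k A] {κ : Type*} (b : Module.Basis κ k A) (w : FreeMonoid κ) :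
    b.tensorAlgebra w = pureTensor k (w.toList.map b) := by
  have h : ∀ w : FreeMonoid κ, FreeAlgebra.basisFreeMonoid k κ w =
      (w.toList.map (FreeAlgebra.ι k)).prod := by
    intro w
    change MonoidAlgebra.lift k (FreeAlgebra k κ) (FreeMonoid κ)
      (FreeMonoid.lift (FreeAlgebra.ι k)) (MonoidAlgebra.single w 1) = _
    rw [MonoidAlgebra.lift_single, one_smul, FreeMonoid.lift_apply]
  rw [Module.Basis.tensorAlgebra, Module.Basis.map_apply, h]
  simp [pureTensor, map_list_prod, Function.comp_def]

section Algebra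

variable (k : Type*) [CommRing k] (A : Type*) [NonUnitalCommRing A] [Module k A]
  [IsScalarTower k A A] [SMulCommClass k A A] (lam : k)

/-- The module `Ш⁺(A) = ⨁ n, A^{⊗ n}` of a commutative, not necessarily unital, `k`-algebra `A`
(the underlying module of the tensor algebra). It is made into a commutative unital `k`-algebra by
the mixable shuffle product of weight `λ`, not by concatenation. -/
def ShPlus (k : Type*) [CommRing k] (A : Type*) [NonUnitalCommRing A] [Module k A]
    (_lam : k) : Type _ :=
  TensorAlgebra k A

namespace ShPlus

instance instCommRing : CommRing (ShPlus k A lam) :=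
  { (inferInstanceAs (AddCommGroup (TensorAlgebra k A)) : AddCommGroup (ShPlus k A lam)) with
    mul := fun x y => mixProd k A lam x y
    one := (1 : TensorAlgebra k A)
    mul_assoc := mixProd_assoc lam
    mul_comm := mixProd_comm lam
    one_mul := mixProd_one_left lam
    mul_one := mixProd_one_right lam
    left_distrib := fun x y z => (mixProd k A lam x).map_add' y z
    right_distrib := fun x y z => LinearMap.map_add₂ (mixProd k A lam) x y z
    zero_mul := fun x => LinearMap.map_zero₂ (mixProd k A lam) x
    mul_zero := fun x => LinearMap.map_zero (mixProd k A lam x) }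

instance instAlgebra : Algebra k (ShPlus k A lam) :=
  letI : Module k (ShPlus k A lam) := inferInstanceAs (Module k (TensorAlgebra k A))
  Algebra.ofModule (fun c x y => LinearMap.map_smul₂ (mixProd k A lam) c x y)
    (fun c x y => map_smul (mixProd k A lam x) c y)

/-- The identification of modules of the tensor algebra with `Ш⁺(A)`; it does not preserve
products. -/
def ofTensor : TensorAlgebra k A ≃ₗ[k] ShPlus k A lam where
  toFun x := x
  invFun x := x
  map_add' _ _ := rfl
  map_smul' _ _ := rfl
  left_inv _ := rfl
  right_inv _ := rfl

theorem ofTensor_one : ofTensor k A lam 1 = 1 := rfl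

theorem ofTensor_mixProd (x y : TensorAlgebra k A) :
    ofTensor k A lam (mixProd k A lam x y) = ofTensor k A lam x * ofTensor k A lam y := rfl

variable {A}

/-- The pure tensor `a₁ ⊗ ⋯ ⊗ aᵣ` as an element of `Ш⁺(A)`. -/
def word (l : List A) : ShPlus k A lam := ofTensor k A lam (pureTensor k l)

variable {k}

/-- The basis of `Ш⁺(A)` that consists of the words in a basis of `A`; see `wordBasis_apply`. -/
def wordBasis {κ : Type*} (b : Module.Basis κ k A) :
    Module.Basis (FreeMonoid κ) k (ShPlus k A lam) :=
  b.tensorAlgebra.map (ofTensor k A lam)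

variable {B : Type*} [NonUnitalCommRing B] [Module k B] [IsScalarTower k B B] [SMulCommClass k B B]

/-- The map `Ш⁺(A) → Ш⁺(B)`, `a₁ ⊗ ⋯ ⊗ aᵣ ↦ f a₁ ⊗ ⋯ ⊗ f aᵣ`, induced by `f : A → B`. -/
def map (f : A →ₗ[k] B) : ShPlus k A lam →ₗ[k] ShPlus k B lam :=
  (ofTensor k B lam).toLinearMap ∘ₗ
    (TensorAlgebra.lift k (TensorAlgebra.ι k ∘ₗ f)).toLinearMap ∘ₗ
      (ofTensor k A lam).symm.toLinearMap

theorem wordBasis_apply {κ : Type*} (b : Module.Basis κ k A) (w : FreeMonoid κ) :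
    wordBasis lam b w = word k lam (w.toList.map b) := by
  rw [wordBasis, Module.Basis.map_apply, tensorAlgebra_basis_apply, word]

theorem word_cons_mul_cons (x y : A) (a b : List A) :
    word k lam (x :: a) * word k lam (y :: b) =
      ofTensor k A lam
        (TensorAlgebra.ι k x * (ofTensor k A lam).symm (word k lam a * word k lam (y :: b)) +
         TensorAlgebra.ι k y * (ofTensor k A lam).symm (word k lam (x :: a) * word k lam b) +
         lam • (TensorAlgebra.ι k (x * y) *
           (ofTensor k A lam).symm (word k lam a * word k lam b))) :=
  mixProd_cons_cons lam x y a b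

theorem map_word (f : A →ₗ[k] B) (l : List A) :
    map lam f (word k lam l) = word k lam (l.map f) := by
  simp [map, word, pureTensor, map_list_prod, Function.comp_def]

end ShPlus
end Algebra

section Hopf

/-- A Hopf algebra structure on a given `k`-algebra `H`: a comultiplication and a counit that are
algebra homomorphisms and satisfy the coalgebra axioms, and an antipode. These are the data and the
axioms of `HopfAlgebra`, with the algebra structure fixed in advance. -/
structure HopfStructure (k : Type*) [CommRing k] (H : Type*) [Ring H] [Algebra k H] where
  comul : H →ₐ[k] H ⊗[k] H
  counit : H →ₐ[k] k
  antipode : H →ₗ[k] H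
  coassoc : TensorProduct.assoc k H H H ∘ₗ comul.toLinearMap.rTensor H ∘ₗ comul.toLinearMap =
    comul.toLinearMap.lTensor H ∘ₗ comul.toLinearMap
  rTensor_counit_comp_comul :
    counit.toLinearMap.rTensor H ∘ₗ comul.toLinearMap = TensorProduct.mk k k H 1
  lTensor_counit_comp_comul :
    counit.toLinearMap.lTensor H ∘ₗ comul.toLinearMap = (TensorProduct.mk k H k).flip 1
  mul_antipode_rTensor_comul :
    LinearMap.mul' k H ∘ₗ antipode.rTensor H ∘ₗ comul.toLinearMap =
      Algebra.linearMap k H ∘ₗ counit.toLinearMap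
  mul_antipode_lTensor_comul :
    LinearMap.mul' k H ∘ₗ antipode.lTensor H ∘ₗ comul.toLinearMap =
      Algebra.linearMap k H ∘ₗ counit.toLinearMap

variable {k : Type*} [CommRing k] {H : Type*} [Ring H] [Algebra k H]
  {H' : Type*} [Ring H'] [Algebra k H']

/-- The Hopf algebra given by a Hopf structure on a `k`-algebra. -/
@[reducible]
def HopfStructure.toHopfAlgebra (S : HopfStructure k H) : HopfAlgebra k H :=
  letI _C : Coalgebra k H :=
    { comul := S.comul.toLinearMap
      counit := S.counit.toLinearMap
      coassoc := S.coassoc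
      rTensor_counit_comp_comul := S.rTensor_counit_comp_comul
      lTensor_counit_comp_comul := S.lTensor_counit_comp_comul }
  { Bialgebra.mk' k H (map_one S.counit) (fun {a b} => map_mul S.counit a b)
      (map_one S.comul) (fun {a b} => map_mul S.comul a b) with
    antipode := S.antipode
    mul_antipode_rTensor_comul := S.mul_antipode_rTensor_comul
    mul_antipode_lTensor_comul := S.mul_antipode_lTensor_comul }

/-- An algebra homomorphism that is a homomorphism of Hopf algebras. -/
structure IsHopfHom (S : HopfStructure k H) (S' : HopfStructure k H') (φ : H →ₐ[k] H') : Prop where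
  map_comul : ∀ x, S'.comul (φ x) = Algebra.TensorProduct.map φ φ (S.comul x)
  map_counit : ∀ x, S'.counit (φ x) = S.counit x
  map_antipode : ∀ x, S'.antipode (φ x) = φ (S.antipode x)

end Hopf

section Hoffman

theorem finite_rearrangements_aux {X : Type*} (n : ℕ) : ∀ l : List X,
    {v : List (Option X) | v.length = n ∧ v.reduceOption = l}.Finite := by
  induction n with
  | zero =>
    intro l
    refine (Set.finite_singleton ([] : List (Option X))).subset ?_
    rintro v ⟨hv, -⟩
    exact List.length_eq_zero_iff.1 hv
  | succ n ih =>
    intro l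
    refine (((ih l).image (List.cons none)).union
      ((ih l.tail).image fun v => l.head?.map some |>.elim [] (· :: v))).subset ?_
    rintro v ⟨hv, hl⟩
    rcases v with _ | ⟨x, v⟩
    · simp at hv
    · rcases x with _ | x
      · left
        exact ⟨v, ⟨by simpa using hv, by simpa [List.reduceOption] using hl⟩, rfl⟩
      · right
        rw [List.reduceOption_cons_of_some] at hl
        subst hl
        exact ⟨v, ⟨by simpa using hv, rfl⟩, rfl⟩

theorem finite_rearrangements {X : Type*} (w : List (Option X)) :
    {v : List (Option X) | v.length = w.length ∧ v.reduceOption = w.reduceOption}.Finite :=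
  finite_rearrangements_aux _ _

/-- A Hoffman set: a locally finite set `X` (graded by positive degrees with finitely many letters
in each degree) with a commutative and associative pairing on `X ∪ {0}`, for which `0` is absorbing,
that is identically zero or additive on degrees. In the second case only the nonzero values of the
pairing are required to have the right degree. -/
class HoffmanSet (X : Type*) where
  deg : X → ℕ
  deg_pos : ∀ a, 1 ≤ deg a
  finite_deg : ∀ n, {a | deg a = n}.Finite
  pairing : WithZero X → WithZero X → WithZero X
  pairing_zero : ∀ a, pairing a 0 = 0
  pairing_comm : ∀ a b, pairing a b = pairing b a
  pairing_assoc : ∀ a b c, pairing (pairing a b) c = pairing a (pairing b c)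
  deg_pairing : (∀ a b, pairing a b = 0) ∨
    ∀ a b c : X, pairing a b = c → deg c = deg a + deg b

/-- The free `k`-module `A` on `X`, with the product that extends the pairing of `X` bilinearly. -/
def HoffmanAlgebra (k : Type*) [CommRing k] (X : Type*) : Type _ := X →₀ k

namespace HoffmanAlgebra

variable (k : Type*) [CommRing k] (X : Type*)

instance instAddCommGroup : AddCommGroup (HoffmanAlgebra k X) :=
  inferInstanceAs (AddCommGroup (X →₀ k))

instance instModule : Module k (HoffmanAlgebra k X) :=
  inferInstanceAs (Module k (X →₀ k))

/-- The basis `X` of the algebra generated by `X`. -/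
def basis : Module.Basis X k (HoffmanAlgebra k X) :=
  (Finsupp.basisSingleOne : Module.Basis X k (X →₀ k))

variable {X}

/-- The map `X ∪ {0} → A`. -/
def letter : WithZero X → HoffmanAlgebra k X
  | none => 0
  | some x => basis k X x

theorem letter_zero : letter k (0 : WithZero X) = 0 := rfl

theorem letter_coe (x : X) : letter k (x : WithZero X) = basis k X x := rfl

variable (X) [HoffmanSet X]

/-- The bilinear extension of the pairing. -/
def mulBilin : HoffmanAlgebra k X →ₗ[k] HoffmanAlgebra k X →ₗ[k] HoffmanAlgebra k X :=
  (basis k X).constr k fun a => (basis k X).constr k fun b =>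
    letter k (HoffmanSet.pairing (a : WithZero X) (b : WithZero X))

variable {X}

theorem mulBilin_letter (a b : WithZero X) :
    mulBilin k X (letter k a) (letter k b) = letter k (HoffmanSet.pairing a b) := by
  induction a using WithZero.recZeroCoe with
  | zero =>
    rw [HoffmanSet.pairing_comm, HoffmanSet.pairing_zero, letter_zero, map_zero,
      LinearMap.zero_apply]
  | coe a =>
    induction b using WithZero.recZeroCoe with
    | zero => rw [HoffmanSet.pairing_zero, letter_zero, map_zero]
    | coe b => simp only [letter_coe, mulBilin, Module.Basis.constr_basis]

theorem mulBilin_comm (x y : HoffmanAlgebra k X) : mulBilin k X x y = mulBilin k X y x := by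
  have key : mulBilin k X = (mulBilin k X).flip := by
    refine (basis k X).ext fun a => (basis k X).ext fun b => ?_
    simp only [LinearMap.flip_apply, ← letter_coe, mulBilin_letter]
    rw [HoffmanSet.pairing_comm]
  exact LinearMap.congr_fun (LinearMap.congr_fun key x) y

theorem mulBilin_assoc (x y z : HoffmanAlgebra k X) :
    mulBilin k X (mulBilin k X x y) z = mulBilin k X x (mulBilin k X y z) := by
  have key : (mulBilin k X).compr₂ (mulBilin k X) =
      (LinearMap.llcomp k _ _ _).flip (mulBilin k X) ∘ₗ
        (LinearMap.llcomp k _ _ _ ∘ₗ mulBilin k X) := by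
    refine (basis k X).ext fun a => (basis k X).ext fun b => (basis k X).ext fun c => ?_
    change mulBilin k X (mulBilin k X (basis k X a) (basis k X b)) (basis k X c) =
      mulBilin k X (basis k X a) (mulBilin k X (basis k X b) (basis k X c))
    simp only [← letter_coe, mulBilin_letter, HoffmanSet.pairing_assoc]
  exact LinearMap.congr_fun (LinearMap.congr_fun (LinearMap.congr_fun key x) y) z

instance instNonUnitalCommRing : NonUnitalCommRing (HoffmanAlgebra k X) :=
  { instAddCommGroup k X with
    mul := fun x y => mulBilin k X x y
    mul_assoc := mulBilin_assoc k
    mul_comm := mulBilin_comm k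
    left_distrib := fun x y z => map_add (mulBilin k X x) y z
    right_distrib := fun x y z => LinearMap.map_add₂ (mulBilin k X) x y z
    zero_mul := fun x => LinearMap.map_zero₂ (mulBilin k X) x
    mul_zero := fun x => map_zero (mulBilin k X x) }

instance instIsScalarTower : IsScalarTower k (HoffmanAlgebra k X) (HoffmanAlgebra k X) :=
  ⟨fun c x y => LinearMap.map_smul₂ (mulBilin k X) c x y⟩

instance instSMulCommClass : SMulCommClass k (HoffmanAlgebra k X) (HoffmanAlgebra k X) :=
  ⟨fun c x y => (map_smul (mulBilin k X x) c y).symm⟩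

end HoffmanAlgebra

variable (k : Type*) [CommRing k] (X : Type*) [HoffmanSet X] (lam : k)

/-- The unitary algebra `Ã = k ⊕ A` generated by `X`. -/
abbrev HoffmanUnitalAlgebra : Type _ := Unitization k (HoffmanAlgebra k X)

/-- The map `γ⁺ : Ш⁺(k) → Ш⁺(Ã)`, `1_k^{⊗ n} ↦ 1_Ã^{⊗ n}`. -/
def gammaPlus : ShPlus k k lam →ₗ[k] ShPlus k (HoffmanUnitalAlgebra k X) lam :=
  ShPlus.map lam (Algebra.linearMap k (HoffmanUnitalAlgebra k X))

/-- The inclusion `Ш⁺(A) → Ш⁺(Ã)` induced by the inclusion of `A` in `Ã`. -/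
def betaPlus : ShPlus k (HoffmanAlgebra k X) lam →ₗ[k] ShPlus k (HoffmanUnitalAlgebra k X) lam :=
  ShPlus.map lam (Unitization.inrHom k k (HoffmanAlgebra k X))

variable {X}

/-- The letters of `X̃ = {1_Ã} ∪ X`, which form a basis of `Ã`; `none` stands for `1_Ã`. -/
def extendedLetter : Option X → HoffmanUnitalAlgebra k X
  | none => 1
  | some x => Unitization.inr (HoffmanAlgebra.basis k X x)

/-- The pure tensor in `Ш⁺(Ã)` of a word in the letters of `X̃`. -/
def extendedWord (w : List (Option X)) : ShPlus k (HoffmanUnitalAlgebra k X) lam :=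
  ShPlus.word k lam (w.map (extendedLetter k))

/-- The one-shuffled element of a word `w` in the letters of `X̃`: the sum of all words `v` of the
same length as `w` whose subsequence of letters different from `1_Ã` is the same as that of `w`. -/
def oneShuffled (w : List (Option X)) : ShPlus k (HoffmanUnitalAlgebra k X) lam :=
  ∑ v ∈ (finite_rearrangements w).toFinset, extendedWord k lam v

variable (X)

/-- The comultiplication of `Ш⁺(A)`: on words in the letters of `X`,
`x₁ ⊗ ⋯ ⊗ xₙ ↦ ∑ i, (x₁ ⊗ ⋯ ⊗ xᵢ) ⊗ (xᵢ₊₁ ⊗ ⋯ ⊗ xₙ)`, `0 ≤ i ≤ n`. -/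
def deconcatenation : ShPlus k (HoffmanAlgebra k X) lam →ₗ[k]
    ShPlus k (HoffmanAlgebra k X) lam ⊗[k] ShPlus k (HoffmanAlgebra k X) lam :=
  (ShPlus.wordBasis lam (HoffmanAlgebra.basis k X)).constr k fun w =>
    ∑ i ∈ Finset.range (w.length + 1),
      ShPlus.word k lam ((w.toList.take i).map (HoffmanAlgebra.basis k X)) ⊗ₜ[k]
        ShPlus.word k lam ((w.toList.drop i).map (HoffmanAlgebra.basis k X))

/-- The counit of `Ш⁺(A)`: `1` on the empty word and `0` on all other words. -/
def deconcatenationCounit : ShPlus k (HoffmanAlgebra k X) lam →ₗ[k] k :=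
  (ShPlus.wordBasis lam (HoffmanAlgebra.basis k X)).constr k fun w => if w.length = 0 then 1 else 0

variable {k}

/-- The element `1_k^{⊗ n}` of `Ш⁺(k)`. -/
def onePower (n : ℕ) : ShPlus k k lam := ShPlus.word k lam (List.replicate n 1)

/-- The comultiplication of `Ш⁺(k)` (the Hopf algebra of Andrews, Guo, Keigher and Ono on the
free Rota-Baxter algebra of weight `λ` on `k`): with `aₙ = 1_k^{⊗ n}`,
`aₙ ↦ ∑ (-λ)^j aᵢ ⊗ aₗ` over all `i + j + l = n`. -/
def baseComul : ShPlus k k lam →ₗ[k] ShPlus k k lam ⊗[k] ShPlus k k lam :=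
  (ShPlus.wordBasis lam (Module.Basis.singleton Unit k)).constr k fun w =>
    ∑ j ∈ Finset.range (w.length + 1), ∑ i ∈ Finset.range (w.length - j + 1),
      (-lam) ^ j • (onePower lam i ⊗ₜ[k] onePower lam (w.length - j - i))

/-- The counit of `Ш⁺(k)`: with `aₙ = 1_k^{⊗ n}`, `a₀ ↦ 1`, `a₁ ↦ λ` and `aₙ ↦ 0` for `n ≥ 2`. -/
def baseCounit : ShPlus k k lam →ₗ[k] k :=
  (ShPlus.wordBasis lam (Module.Basis.singleton Unit k)).constr k fun w =>
    if w.length = 0 then 1 else if w.length = 1 then lam else 0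

theorem gammaPlus_onePower (X : Type*) [HoffmanSet X] (n : ℕ) :
    gammaPlus k X lam (onePower lam n) = extendedWord k lam (List.replicate n none) := by
  simp [gammaPlus, onePower, ShPlus.map_word, extendedWord, extendedLetter]

theorem betaPlus_word {X : Type*} [HoffmanSet X] (l : List X) :
    betaPlus k X lam (ShPlus.word k lam (l.map (HoffmanAlgebra.basis k X))) =
      extendedWord k lam (l.map some) := by
  simp [betaPlus, ShPlus.map_word, extendedWord, extendedLetter, Function.comp_def]

theorem wordBasis_onePower (n : ℕ) :
    ShPlus.wordBasis lam (Module.Basis.singleton Unit k)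
      (FreeMonoid.ofList (List.replicate n ())) = onePower lam n := by
  simp [ShPlus.wordBasis_apply, onePower]

theorem baseComul_onePower (n : ℕ) :
    baseComul lam (onePower lam n) =
      ∑ j ∈ Finset.range (n + 1), ∑ i ∈ Finset.range (n - j + 1),
        (-lam) ^ j • (onePower lam i ⊗ₜ[k] onePower lam (n - j - i)) := by
  have h : (FreeMonoid.ofList (List.replicate n ())).length = n := by simp [FreeMonoid.length]
  rw [← wordBasis_onePower, baseComul, Module.Basis.constr_basis, h]

theorem baseCounit_onePower (n : ℕ) :
    baseCounit lam (onePower lam n) = if n = 0 then 1 else if n = 1 then lam else 0 := by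
  have h : (FreeMonoid.ofList (List.replicate n ())).length = n := by simp [FreeMonoid.length]
  rw [← wordBasis_onePower, baseCounit, Module.Basis.constr_basis, h]

theorem deconcatenation_word {X : Type*} [HoffmanSet X] (l : List X) :
    deconcatenation k X lam (ShPlus.word k lam (l.map (HoffmanAlgebra.basis k X))) =
      ∑ i ∈ Finset.range (l.length + 1),
        ShPlus.word k lam ((l.take i).map (HoffmanAlgebra.basis k X)) ⊗ₜ[k]
          ShPlus.word k lam ((l.drop i).map (HoffmanAlgebra.basis k X)) := by
  have h : ShPlus.wordBasis lam (HoffmanAlgebra.basis k X) (FreeMonoid.ofList l) =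
      ShPlus.word k lam (l.map (HoffmanAlgebra.basis k X)) := ShPlus.wordBasis_apply _ _ _
  rw [← h, deconcatenation, Module.Basis.constr_basis]
  rfl

end Hoffman
end MixableShuffle

end

open MixableShuffle

/-! Write a_n for the n-th tensor power of the unit in `Ш⁺(k)`. Since `Ш⁺(Ã)` is commutative, b ⊗ w
↦ γ⁺(b) β(w) is an algebra homomorphism `gammaBeta` on `Ш⁺(k) ⊗ Ш⁺(A)`. Its range is by construction
the product of the two images. Once it is known to be injective with range V, the algebra V is
isomorphic to the tensor product of two Hopf algebras, and the Hopf structure is carried over; both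
factors embed as Hopf subalgebras.

The heart is `gammaPlus_mul_betaPlus`. In the mixable shuffle of n units with a word w in X, a unit
merged with a letter x gives 1 · x = x, so a merger costs a factor λ and deletes one unit. Each
letter of w absorbs at most one unit. Hence γ⁺(a_n) β(w) is the sum over j of binom(|w|, j) λ^j
times the sum of all interleavings of w with n - j units. With D the operator a_n ↦ a_(n-1), this
says that `gammaBeta` is `shuffleMap` after b ⊗ w ↦ (1 + λD)^|w| b ⊗ w. The operator 1 + λD is
invertible because D is locally nilpotent. The map `shuffleMap` sends the basis a_n ⊗ w to the
one-shuffled elements, which have disjoint supports; it is therefore injective, with range V.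

For `Ш⁺(A)`, deconcatenation satisfies Δ(aw) = 1 ⊗ aw + (a · ⊗ id) Δ(w), which fits the recursion of
the product on first letters; the antipode is a geometric series for convolution, finite on each
word. For `Ш⁺(k)`, the relation a_1 a_n = (n + 1) a_(n+1) + nλ a_n shows that a_1 generates in
characteristic zero. So every Hopf axiom is checked at a_1 alone, where a_1 - λ turns out to be
primitive. -/

noncomputable section

namespace MixableShuffle

/-! ### Prefixing a letter, and functoriality of `Ш⁺`. -/

namespace ShPlus

variable {k : Type*} [CommRing k] {A : Type*} [NonUnitalCommRing A] [Module k A]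
  [IsScalarTower k A A] [SMulCommClass k A A] {lam : k}

variable (lam) in
/-- The bilinear map `(a, w) ↦ a ⊗ w` that prefixes a letter. -/
def cons : A →ₗ[k] ShPlus k A lam →ₗ[k] ShPlus k A lam :=
  ((LinearMap.mul k (TensorAlgebra k A)).compl₁₂ (TensorAlgebra.ι k)
    (ofTensor k A lam).symm.toLinearMap).compr₂ (ofTensor k A lam).toLinearMap

theorem word_nil : word k lam ([] : List A) = 1 := rfl

theorem word_cons (a : A) (l : List A) : word k lam (a :: l) = cons lam a (word k lam l) := by
  simp [word, cons, pureTensor_cons]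

theorem cons_zero_add (a : A) (w : ShPlus k A lam) : cons lam a 0 + w = w := by
  rw [map_zero, zero_add]

theorem cons_mul_cons (x y : A) (u v : ShPlus k A lam) :
    cons lam x u * cons lam y v = cons lam x (u * cons lam y v) + cons lam y (cons lam x u * v) +
      lam • cons lam (x * y) (u * v) :=
  mixProd_rec lam x y u v

variable (k lam) in
/-- The multiplication by `w` as a linear map. -/
def mulRight (w : ShPlus k A lam) : ShPlus k A lam →ₗ[k] ShPlus k A lam :=
  LinearMap.mulRight k w

theorem mulRight_apply (w x : ShPlus k A lam) : mulRight k lam w x = x * w := rfl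

theorem hom_ext_word {M : Type*} [AddCommGroup M] [Module k M] {f g : ShPlus k A lam →ₗ[k] M}
    (h : ∀ l : List A, f (word k lam l) = g (word k lam l)) : f = g :=
  ext_pureTensor (f := f ∘ₗ (ofTensor k A lam).toLinearMap)
    (g := g ∘ₗ (ofTensor k A lam).toLinearMap) h

/-- Two linear maps on `Ш⁺(A)` agree if they agree at `1` and their equality at `w` implies their
equality at `a ⊗ w`. -/
theorem hom_ext_cons {M : Type*} [AddCommGroup M] [Module k M] {f g : ShPlus k A lam →ₗ[k] M}
    (h1 : f 1 = g 1) (h : ∀ a x, f x = g x → f (cons lam a x) = g (cons lam a x)) : f = g := by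
  refine hom_ext_word fun l => ?_
  induction l with
  | nil => exact h1
  | cons a l ih => rw [word_cons]; exact h a _ ih

variable {B : Type*} [NonUnitalCommRing B] [Module k B] [IsScalarTower k B B] [SMulCommClass k B B]

theorem map_one' (f : A →ₗ[k] B) : map lam f (1 : ShPlus k A lam) = 1 := map_word lam f []

theorem map_cons (f : A →ₗ[k] B) (a : A) (x : ShPlus k A lam) :
    map lam f (cons lam a x) = cons lam (f a) (map lam f x) := by
  have : map lam f ∘ₗ cons lam a = cons lam (f a) ∘ₗ map lam f := hom_ext_word fun l => by
    simp [← word_cons, map_word]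
  exact LinearMap.congr_fun this x

/-- The product on both sides obeys the same recursion on first letters, and a multiplicative f
respects the merged letter. The double induction used here recurs for the comultiplication and the
counit. -/
theorem map_mul' {f : A →ₗ[k] B} (hf : ∀ a b, f (a * b) = f a * f b) (x y : ShPlus k A lam) :
    map lam f (x * y) = map lam f x * map lam f y := by
  have : (LinearMap.mul k (ShPlus k A lam)).compr₂ (map lam f) =
      (LinearMap.mul k (ShPlus k B lam)).compl₁₂ (map lam f) (map lam f) := by
    refine hom_ext_cons ?_ fun a u hu => hom_ext_cons ?_ fun b v hv => ?_
    · ext v; simp [map_one']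
    · simp [map_one']
    -- The outer hypothesis is an equality of maps in the second factor, so it covers both u · (b ⊗
    -- v) and u · v; the inner one covers (a ⊗ u) · v.
    · have h1 := LinearMap.congr_fun hu (cons lam b v)
      have h2 := LinearMap.congr_fun hu v
      simp only [LinearMap.compr₂_apply, LinearMap.mul_apply', LinearMap.compl₁₂_apply] at *
      simp only [map_cons] at *
      rw [cons_mul_cons, cons_mul_cons]
      simp only [map_add, map_smul, map_cons, h1, h2, hv, hf]
  exact LinearMap.congr_fun (LinearMap.congr_fun this x) y

/-- The algebra homomorphism `Ш⁺(A) → Ш⁺(B)` induced by a multiplicative linear map. -/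
def mapAlgHom (f : A →ₗ[k] B) (hf : ∀ a b, f (a * b) = f a * f b) :
    ShPlus k A lam →ₐ[k] ShPlus k B lam :=
  AlgHom.ofLinearMap (map lam f) (map_one' f) (map_mul' hf)

end ShPlus

/-! ### First-letter recursions for deconcatenation and its counit. -/

section Deconcatenation

variable (k : Type*) [CommRing k] (X : Type*) [HoffmanSet X] (lam : k)

variable {k X} in
theorem hom_ext_basis_word {M : Type*} [AddCommMonoid M] [Module k M]
    {f g : ShPlus k (HoffmanAlgebra k X) lam →ₗ[k] M}
    (h : ∀ l : List X, f (ShPlus.word k lam (l.map (HoffmanAlgebra.basis k X))) =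
      g (ShPlus.word k lam (l.map (HoffmanAlgebra.basis k X)))) : f = g := by
  refine (ShPlus.wordBasis lam (HoffmanAlgebra.basis k X)).ext fun w => ?_
  rw [ShPlus.wordBasis_apply]
  exact h _

theorem deconcatenation_one : deconcatenation k X lam 1 = 1 := by
  have := deconcatenation_word (k := k) lam ([] : List X)
  simpa [ShPlus.word_nil, Algebra.TensorProduct.one_def] using this

/-- The cut is either in front of the first letter or inside the rest. An arbitrary a in A is
allowed, not just a letter of X, because the recursion for the product creates the merged letter x *
y. -/
theorem deconcatenation_cons (a : HoffmanAlgebra k X) (w : ShPlus k (HoffmanAlgebra k X) lam) :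
    deconcatenation k X lam (ShPlus.cons lam a w) =
      1 ⊗ₜ ShPlus.cons lam a w + (ShPlus.cons lam a).rTensor _ (deconcatenation k X lam w) := by
  have key : (ShPlus.cons lam).compr₂ (deconcatenation k X lam) =
      (ShPlus.cons lam).compr₂ (TensorProduct.mk k _ _ 1) +
      ((LinearMap.rTensorHom _ ∘ₗ ShPlus.cons lam).compl₂ (deconcatenation k X lam)) := by
    refine (HoffmanAlgebra.basis k X).ext fun x => hom_ext_basis_word lam fun l => ?_
    simp only [LinearMap.compr₂_apply, LinearMap.add_apply, LinearMap.compl₂_apply,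
      LinearMap.comp_apply, LinearMap.coe_rTensorHom, TensorProduct.mk_apply]
    rw [← ShPlus.word_cons, ← List.map_cons, deconcatenation_word, deconcatenation_word,
      List.length_cons, Finset.sum_range_succ', add_comm]
    simp [map_sum, ← ShPlus.word_cons, ShPlus.word_nil]
  exact LinearMap.congr_fun (LinearMap.congr_fun key a) w

theorem deconcatenationCounit_word (l : List X) :
    deconcatenationCounit k X lam (ShPlus.word k lam (l.map (HoffmanAlgebra.basis k X))) =
      if l.length = 0 then 1 else 0 := by
  have h : ShPlus.wordBasis lam (HoffmanAlgebra.basis k X) (FreeMonoid.ofList l) =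
      ShPlus.word k lam (l.map (HoffmanAlgebra.basis k X)) := ShPlus.wordBasis_apply _ _ _
  rw [← h, deconcatenationCounit, Module.Basis.constr_basis]
  rfl

theorem deconcatenationCounit_one : deconcatenationCounit k X lam 1 = 1 := by
  simpa [ShPlus.word_nil] using deconcatenationCounit_word k X lam []

theorem deconcatenationCounit_cons (a : HoffmanAlgebra k X)
    (w : ShPlus k (HoffmanAlgebra k X) lam) :
    deconcatenationCounit k X lam (ShPlus.cons lam a w) = 0 := by
  have key : (ShPlus.cons lam).compr₂ (deconcatenationCounit k X lam) = 0 := by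
    refine (HoffmanAlgebra.basis k X).ext fun x => hom_ext_basis_word lam fun l => ?_
    simp only [LinearMap.compr₂_apply, LinearMap.zero_apply]
    rw [← ShPlus.word_cons, ← List.map_cons, deconcatenationCounit_word]
    simp
  exact LinearMap.congr_fun (LinearMap.congr_fun key a) w

end Deconcatenation

/-! ### Prefixing in the first tensor factor. -/

namespace ShPlus

variable {k : Type*} [CommRing k] {A : Type*} [NonUnitalCommRing A] [Module k A]
  [IsScalarTower k A A] [SMulCommClass k A A] {lam : k}

theorem rTensor_cons_mul_one_tmul (x : A) (P : ShPlus k A lam ⊗[k] ShPlus k A lam)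
    (w : ShPlus k A lam) :
    (cons lam x).rTensor _ P * (1 ⊗ₜ w) = (cons lam x).rTensor _ (P * (1 ⊗ₜ w)) := by
  induction P with
  | zero => simp
  | tmul p q => simp
  | add p q hp hq => simp only [map_add, add_mul, hp, hq]

theorem one_tmul_mul_rTensor_cons (x : A) (P : ShPlus k A lam ⊗[k] ShPlus k A lam)
    (w : ShPlus k A lam) :
    (1 ⊗ₜ w) * (cons lam x).rTensor _ P = (cons lam x).rTensor _ ((1 ⊗ₜ w) * P) := by
  rw [mul_comm, rTensor_cons_mul_one_tmul, mul_comm]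

/-- The product of a tensor product is factorwise, so `cons_mul_cons` applied in the first factor
gives the same three-term recursion. -/
theorem rTensor_cons_mul_rTensor_cons (x y : A) (P Q : ShPlus k A lam ⊗[k] ShPlus k A lam) :
    (cons lam x).rTensor _ P * (cons lam y).rTensor _ Q =
      (cons lam x).rTensor _ (P * (cons lam y).rTensor _ Q) +
      (cons lam y).rTensor _ ((cons lam x).rTensor _ P * Q) +
      lam • (cons lam (x * y)).rTensor _ (P * Q) := by
  induction P with
  | zero => simp
  | add p q hp hq => simp only [map_add, add_mul, hp, hq, smul_add]; abel
  | tmul p p' =>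
    induction Q with
    | zero => simp
    | add p q hp hq => simp only [map_add, mul_add, hp, hq, smul_add]; abel
    | tmul q q' =>
      simp [cons_mul_cons, TensorProduct.add_tmul, TensorProduct.smul_tmul']

end ShPlus

/-! ### The Hopf algebra `Ш⁺(A)`. -/

section Bialgebra

variable (k : Type*) [CommRing k] (X : Type*) [HoffmanSet X] (lam : k)

/-- Multiply out (1 ⊗ xu + x·Δu)(1 ⊗ yv + y·Δv), where x· prefixes the first factor. The first terms
give 1 ⊗ (xu · yv); the other three, after the recursion for a product of two prefixed tensors,
regroup to x·(Δu Δ(yv)) + y·(Δ(xu) Δv) + λ (xy)·(Δu Δv). -/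
theorem deconcatenation_mul (u v : ShPlus k (HoffmanAlgebra k X) lam) :
    deconcatenation k X lam (u * v) = deconcatenation k X lam u * deconcatenation k X lam v := by
  have key : (LinearMap.mul k _).compr₂ (deconcatenation k X lam) =
      (LinearMap.mul k _).compl₁₂ (deconcatenation k X lam) (deconcatenation k X lam) := by
    refine ShPlus.hom_ext_cons ?_ fun x u hu => ShPlus.hom_ext_cons ?_ fun y v hv => ?_
    · ext v; simp [deconcatenation_one]
    · simp [deconcatenation_one]
    · have h1 := LinearMap.congr_fun hu (ShPlus.cons lam y v)
      have h2 := LinearMap.congr_fun hu v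
      simp only [LinearMap.compr₂_apply, LinearMap.mul_apply', LinearMap.compl₁₂_apply] at *
      rw [ShPlus.cons_mul_cons, map_add, map_add, map_smul, deconcatenation_cons,
        deconcatenation_cons, deconcatenation_cons, h1, h2, hv, deconcatenation_cons,
        deconcatenation_cons]
      simp only [mul_add, add_mul]
      rw [ShPlus.rTensor_cons_mul_rTensor_cons, ShPlus.rTensor_cons_mul_one_tmul,
        ShPlus.one_tmul_mul_rTensor_cons, Algebra.TensorProduct.tmul_mul_tmul,
        ShPlus.cons_mul_cons]
      simp only [map_add, smul_add, TensorProduct.tmul_add,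
        TensorProduct.tmul_smul, one_mul]
      abel
  exact LinearMap.congr_fun (LinearMap.congr_fun key u) v

/-- Every term in the product of two nonempty tensors has a first letter, so both sides vanish
there. -/
theorem deconcatenationCounit_mul (u v : ShPlus k (HoffmanAlgebra k X) lam) :
    deconcatenationCounit k X lam (u * v) =
      deconcatenationCounit k X lam u * deconcatenationCounit k X lam v := by
  have key : (LinearMap.mul k _).compr₂ (deconcatenationCounit k X lam) =
      (LinearMap.mul k _).compl₁₂ (deconcatenationCounit k X lam)
        (deconcatenationCounit k X lam) := by
    refine ShPlus.hom_ext_cons ?_ fun x u hu => ShPlus.hom_ext_cons ?_ fun y v hv => ?_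
    · ext v; simp [deconcatenationCounit_one]
    · simp [deconcatenationCounit_one]
    · simp [ShPlus.cons_mul_cons, deconcatenationCounit_cons]
  exact LinearMap.congr_fun (LinearMap.congr_fun key u) v

/-- Deconcatenation as a homomorphism of algebras. -/
def deconcatenationAlgHom : ShPlus k (HoffmanAlgebra k X) lam →ₐ[k]
    ShPlus k (HoffmanAlgebra k X) lam ⊗[k] ShPlus k (HoffmanAlgebra k X) lam :=
  AlgHom.ofLinearMap (deconcatenation k X lam) (deconcatenation_one k X lam)
    (deconcatenation_mul k X lam)

/-- The counit of `Ш⁺(A)` as a homomorphism of algebras. -/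
def deconcatenationCounitAlgHom : ShPlus k (HoffmanAlgebra k X) lam →ₐ[k] k :=
  AlgHom.ofLinearMap (deconcatenationCounit k X lam) (deconcatenationCounit_one k X lam)
    (deconcatenationCounit_mul k X lam)

/-- The deconcatenation coalgebra `Ш⁺(A)`. -/
@[reducible]
def deconcatenationCoalgebra : Coalgebra k (ShPlus k (HoffmanAlgebra k X) lam) where
  comul := deconcatenation k X lam
  counit := deconcatenationCounit k X lam
  coassoc := by
    refine ShPlus.hom_ext_cons ?_ fun a w hw => ?_
    · simp [deconcatenation_one, Algebra.TensorProduct.one_def]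
    -- Applying Δ to a prefixed first factor commutes with prefixing, except for the extra term that
    -- comes from the cut in front of a.
    · have h1 : ∀ z : (ShPlus k (HoffmanAlgebra k X) lam) ⊗[k] (ShPlus k (HoffmanAlgebra k X) lam),
          TensorProduct.assoc k _ _ _ ((deconcatenation k X lam).rTensor _
            ((ShPlus.cons lam a).rTensor _ z)) =
          1 ⊗ₜ ((ShPlus.cons lam a).rTensor _ z) + (ShPlus.cons lam a).rTensor _
            (TensorProduct.assoc k _ _ _ ((deconcatenation k X lam).rTensor _ z)) := by
        intro z
        induction z with
        | zero => simp
        | add x y hx hy => simp only [map_add, TensorProduct.tmul_add, hx, hy]; abel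
        | tmul x y =>
          simp only [LinearMap.rTensor_tmul, deconcatenation_cons, TensorProduct.add_tmul,
            map_add, TensorProduct.assoc_tmul]
          congr 1
          generalize deconcatenation k X lam x = t
          induction t with
          | zero => simp
          | add x y hx hy => simp only [map_add, TensorProduct.add_tmul, hx, hy]
          | tmul => simp
      have h2 : ∀ z : (ShPlus k (HoffmanAlgebra k X) lam) ⊗[k] (ShPlus k (HoffmanAlgebra k X) lam),
          (deconcatenation k X lam).lTensor _ ((ShPlus.cons lam a).rTensor _ z) =
          (ShPlus.cons lam a).rTensor _ ((deconcatenation k X lam).lTensor _ z) := fun z => by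
        rw [← LinearMap.comp_apply, ← LinearMap.comp_apply, LinearMap.lTensor_comp_rTensor,
          LinearMap.rTensor_comp_lTensor]
      simp only [LinearMap.comp_apply, LinearEquiv.coe_coe] at *
      rw [deconcatenation_cons, map_add, map_add, map_add, h1, hw, h2, LinearMap.rTensor_tmul,
        LinearMap.lTensor_tmul, deconcatenation_one, deconcatenation_cons,
        Algebra.TensorProduct.one_def, TensorProduct.assoc_tmul, TensorProduct.tmul_add, add_assoc]
  rTensor_counit_comp_comul := by
    refine ShPlus.hom_ext_cons ?_ fun a w hw => ?_
    · simp [deconcatenation_one, deconcatenationCounit_one, Algebra.TensorProduct.one_def]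
    · have h : deconcatenationCounit k X lam ∘ₗ ShPlus.cons lam a = 0 :=
        LinearMap.ext (deconcatenationCounit_cons k X lam a)
      rw [LinearMap.comp_apply, deconcatenation_cons, map_add, ← LinearMap.rTensor_comp_apply, h]
      simp [deconcatenationCounit_one]
  lTensor_counit_comp_comul := by
    refine ShPlus.hom_ext_cons ?_ fun a w hw => ?_
    · simp [deconcatenation_one, deconcatenationCounit_one, Algebra.TensorProduct.one_def]
    · rw [LinearMap.comp_apply] at hw
      rw [LinearMap.comp_apply, deconcatenation_cons, map_add, ← LinearMap.comp_apply,
        LinearMap.lTensor_comp_rTensor, ← LinearMap.rTensor_comp_lTensor, LinearMap.comp_apply, hw]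
      simp [deconcatenationCounit_cons]

open WithConv in
/-- The difference of `ηε` and the identity in the convolution algebra of `Ш⁺(A)`. -/
def convDefect :
    letI := deconcatenationCoalgebra k X lam
    WithConv (ShPlus k (HoffmanAlgebra k X) lam →ₗ[k] ShPlus k (HoffmanAlgebra k X) lam) :=
  letI := deconcatenationCoalgebra k X lam
  1 - toConv LinearMap.id

variable {k X} in
theorem conv_apply_word
    (f g : WithConv (ShPlus k (HoffmanAlgebra k X) lam →ₗ[k] ShPlus k (HoffmanAlgebra k X) lam))
    (l : List X) :
    letI := deconcatenationCoalgebra k X lam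
    (f * g) (ShPlus.word k lam (l.map (HoffmanAlgebra.basis k X))) =
      ∑ i ∈ Finset.range (l.length + 1),
        f (ShPlus.word k lam ((l.take i).map (HoffmanAlgebra.basis k X))) *
          g (ShPlus.word k lam ((l.drop i).map (HoffmanAlgebra.basis k X))) := by
  let := deconcatenationCoalgebra k X lam
  rw [LinearMap.convMul_apply]
  change LinearMap.mul' k _ (TensorProduct.map _ _ (deconcatenation k X lam _)) = _
  rw [deconcatenation_word]
  simp

theorem convDefect_one : convDefect k X lam 1 = 0 := by
  let := deconcatenationCoalgebra k X lam
  change algebraMap k (ShPlus k (HoffmanAlgebra k X) lam) (deconcatenationCounit k X lam 1) - 1 = 0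
  rw [deconcatenationCounit_one, map_one, sub_self]

/-- The defect kills the empty word, so only splittings of a word into n nonempty pieces can
contribute to the n-th convolution power. -/
theorem convDefect_pow_word (n : ℕ) (l : List X) (h : l.length < n) :
    letI := deconcatenationCoalgebra k X lam
    (convDefect k X lam ^ n) (ShPlus.word k lam (l.map (HoffmanAlgebra.basis k X))) = 0 := by
  let := deconcatenationCoalgebra k X lam
  induction n generalizing l with
  | zero => omega
  | succ n ih =>
    rw [pow_succ', conv_apply_word]
    refine Finset.sum_eq_zero fun i hi => ?_
    rw [Finset.mem_range] at hi
    -- An empty prefix is killed by the first factor; a nonempty one leaves a suffix short enough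
    -- for the induction hypothesis.
    rcases i with _ | i
    · simp [ShPlus.word_nil, convDefect_one]
    · rw [ih _ (by rw [List.length_drop]; omega), mul_zero]

/-- The antipode of `Ш⁺(A)`, given on words by the geometric series of `convDefect`. -/
def deconcatenationAntipode :
    ShPlus k (HoffmanAlgebra k X) lam →ₗ[k] ShPlus k (HoffmanAlgebra k X) lam :=
  letI := deconcatenationCoalgebra k X lam
  (ShPlus.wordBasis lam (HoffmanAlgebra.basis k X)).constr k fun w =>
    ∑ i ∈ Finset.range (w.length + 1), (convDefect k X lam ^ i)
      (ShPlus.wordBasis lam (HoffmanAlgebra.basis k X) w)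

/-- A longer truncation of the series only adds terms that vanish on the word. Thus one truncation
serves all prefixes and suffixes of a given word at once, which makes identities in the convolution
ring applicable. -/
theorem deconcatenationAntipode_word (l : List X) (n : ℕ) (h : l.length < n) :
    letI := deconcatenationCoalgebra k X lam
    deconcatenationAntipode k X lam (ShPlus.word k lam (l.map (HoffmanAlgebra.basis k X))) =
      (∑ i ∈ Finset.range n, convDefect k X lam ^ i)
        (ShPlus.word k lam (l.map (HoffmanAlgebra.basis k X))) := by
  let := deconcatenationCoalgebra k X lam
  have hl : ShPlus.wordBasis lam (HoffmanAlgebra.basis k X) (FreeMonoid.ofList l) =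
      ShPlus.word k lam (l.map (HoffmanAlgebra.basis k X)) := ShPlus.wordBasis_apply _ _ _
  have hs : ∀ (s : Finset ℕ) (x : ShPlus k (HoffmanAlgebra k X) lam),
      (∑ i ∈ s, convDefect k X lam ^ i) x = ∑ i ∈ s, (convDefect k X lam ^ i) x := by
    intro s x
    induction s using Finset.induction_on with
    | empty => simp
    | insert a s ha ih => rw [Finset.sum_insert ha, Finset.sum_insert ha, ← ih]; rfl
  rw [hs, ← hl, deconcatenationAntipode, Module.Basis.constr_basis]
  refine Finset.sum_subset (fun i hi => ?_) fun i _ hi => ?_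
  · simp only [Finset.mem_range] at *
    exact lt_of_lt_of_le hi h
  · rw [hl]
    refine convDefect_pow_word k X lam i l ?_
    simp only [Finset.mem_range, not_lt] at hi
    exact hi

open WithConv in
-- The identity is 1 - d for the convolution defect d, and (1 + d + ⋯ + d^|l|)(1 - d) = 1 - d^(|l| +
-- 1), whose last term vanishes on the word l.
theorem deconcatenationAntipode_conv_id :
    letI := deconcatenationCoalgebra k X lam
    toConv (deconcatenationAntipode k X lam) * toConv LinearMap.id = 1 := by
  let := deconcatenationCoalgebra k X lam
  refine ofConv_injective (hom_ext_basis_word lam fun l => ?_)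
  have h : ((∑ i ∈ Finset.range (l.length + 1), convDefect k X lam ^ i) * toConv LinearMap.id) =
      1 - convDefect k X lam ^ (l.length + 1) := by
    rw [← geom_sum_mul_neg, convDefect, sub_sub_cancel]
  have h2 := congrArg (fun f => f (ShPlus.word k lam (l.map (HoffmanAlgebra.basis k X)))) h
  have h3 := convDefect_pow_word k X lam (l.length + 1) l (Nat.lt_succ_self _)
  rw [conv_apply_word]
  simp only [conv_apply_word] at h2
  refine (Finset.sum_congr rfl fun i _ => ?_).trans
    (h2.trans ((congrArg (fun x => _ - x) h3).trans (sub_zero _)))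
  congr 1
  exact deconcatenationAntipode_word k X lam _ _ (by rw [List.length_take]; omega)

open WithConv in
theorem id_conv_deconcatenationAntipode :
    letI := deconcatenationCoalgebra k X lam
    toConv LinearMap.id * toConv (deconcatenationAntipode k X lam) = 1 := by
  let := deconcatenationCoalgebra k X lam
  refine ofConv_injective (hom_ext_basis_word lam fun l => ?_)
  have h : (toConv LinearMap.id * (∑ i ∈ Finset.range (l.length + 1), convDefect k X lam ^ i)) =
      1 - convDefect k X lam ^ (l.length + 1) := by
    rw [← mul_neg_geom_sum, convDefect, sub_sub_cancel]
  have h2 := congrArg (fun f => f (ShPlus.word k lam (l.map (HoffmanAlgebra.basis k X)))) h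
  have h3 := convDefect_pow_word k X lam (l.length + 1) l (Nat.lt_succ_self _)
  rw [conv_apply_word]
  simp only [conv_apply_word] at h2
  refine (Finset.sum_congr rfl fun i _ => ?_).trans
    (h2.trans ((congrArg (fun x => _ - x) h3).trans (sub_zero _)))
  congr 1
  exact deconcatenationAntipode_word k X lam _ _ (by rw [List.length_drop]; omega)

open WithConv in
/-- The Hopf algebra structure of `Ш⁺(A)` with deconcatenation as comultiplication. -/
def deconcatenationHopf : HopfStructure k (ShPlus k (HoffmanAlgebra k X) lam) where
  comul := deconcatenationAlgHom k X lam
  counit := deconcatenationCounitAlgHom k X lam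
  antipode := deconcatenationAntipode k X lam
  coassoc := (deconcatenationCoalgebra k X lam).coassoc
  rTensor_counit_comp_comul := (deconcatenationCoalgebra k X lam).rTensor_counit_comp_comul
  lTensor_counit_comp_comul := (deconcatenationCoalgebra k X lam).lTensor_counit_comp_comul
  mul_antipode_rTensor_comul := congrArg ofConv (deconcatenationAntipode_conv_id k X lam)
  mul_antipode_lTensor_comul := congrArg ofConv (id_conv_deconcatenationAntipode k X lam)

end Bialgebra

/-- A linear map between algebras that preserves `1` and the multiplication by the elements of a
generating set is an algebra homomorphism. -/
def algHomOfAdjoin {k R S : Type*} [CommRing k] [CommRing R] [CommRing S] [Algebra k R]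
    [Algebra k S] {s : Set R} (hs : Algebra.adjoin k s = ⊤) (f : R →ₗ[k] S) (h1 : f 1 = 1)
    (hf : ∀ a ∈ s, ∀ b, f (a * b) = f a * f b) : R →ₐ[k] S :=
  AlgHom.ofLinearMap f h1 fun x => by
    have hx : x ∈ Algebra.adjoin k s := hs ▸ trivial
    induction hx using Algebra.adjoin_induction with
    | mem a ha => exact hf a ha
    | algebraMap r =>
      intro y
      rw [← Algebra.smul_def, map_smul, Algebra.algebraMap_eq_smul_one, map_smul, h1,
        smul_one_mul]
    | add a b _ _ ha hb => intro y; rw [add_mul, map_add, ha, hb, map_add, add_mul]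
    | mul a b _ _ ha hb => intro y; rw [mul_assoc, ha, hb, ha, mul_assoc]

/-! ### The Hopf algebra `Ш⁺(k)`. -/

section Base

section CommRing

variable {k : Type*} [CommRing k] (lam : k)

theorem onePower_zero : onePower lam 0 = 1 := rfl

theorem onePower_succ (n : ℕ) : onePower lam (n + 1) = ShPlus.cons lam 1 (onePower lam n) := by
  rw [onePower, List.replicate_succ, ShPlus.word_cons, onePower]

variable {lam} in
-- A word over a one-letter alphabet is determined by its length, so the a_n form a basis.
theorem hom_ext_onePower {M : Type*} [AddCommMonoid M] [Module k M] {f g : ShPlus k k lam →ₗ[k] M}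
    (h : ∀ n, f (onePower lam n) = g (onePower lam n)) : f = g := by
  refine (ShPlus.wordBasis lam (Module.Basis.singleton Unit k)).ext fun w => ?_
  have : w = FreeMonoid.ofList (List.replicate w.length ()) :=
    List.eq_replicate_iff.2 ⟨rfl, fun _ _ => rfl⟩
  rw [this, wordBasis_onePower]
  exact h _

/-- One letter can be placed among n equal letters in n + 1 ways and merged with each of them in one
way. -/
theorem onePower_one_mul (n : ℕ) : onePower lam 1 * onePower lam n =
    ((n + 1 : ℕ) : k) • onePower lam (n + 1) + (n * lam) • onePower lam n := by
  induction n with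
  | zero => simp [onePower_zero]
  | succ n ih =>
    rw [onePower_succ lam 0] at ih ⊢
    rw [onePower_succ lam n, ShPlus.cons_mul_cons, ih, ← onePower_succ, onePower_zero, one_mul,
      map_add, map_smul, map_smul, ← onePower_succ, ← onePower_succ, one_mul, one_mul,
      ← onePower_succ]
    push_cast
    module

/-- The sum of `aᵢ ⊗ aₗ` over all `i + l = n`. -/
def onePowerComul (n : ℕ) : ShPlus k k lam ⊗[k] ShPlus k k lam :=
  ∑ p ∈ Finset.HasAntidiagonal.antidiagonal n, onePower lam p.1 ⊗ₜ[k] onePower lam p.2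

/-- The elements D_n = ∑ aᵢ ⊗ aₗ, i + l = n, thus obey the recursion of the a_n themselves, with a_1
replaced by a_1 ⊗ 1 + 1 ⊗ a_1. The coefficients n + 1 and n split as i + l over the antidiagonals.
-/
theorem mul_onePowerComul (n : ℕ) :
    (onePower lam 1 ⊗ₜ[k] 1 + 1 ⊗ₜ[k] onePower lam 1) * onePowerComul lam n =
      ((n + 1 : ℕ) : k) • onePowerComul lam (n + 1) + (n * lam) • onePowerComul lam n := by
  have h1 : ((n + 1 : ℕ) : k) • onePowerComul lam (n + 1) =
      ∑ p ∈ Finset.HasAntidiagonal.antidiagonal (n + 1), (p.1 : k) • onePower lam p.1 ⊗ₜ[k] onePower lam p.2 +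
      ∑ p ∈ Finset.HasAntidiagonal.antidiagonal (n + 1), (p.2 : k) • onePower lam p.1 ⊗ₜ[k] onePower lam p.2 := by
    rw [onePowerComul, Finset.smul_sum, ← Finset.sum_add_distrib]
    refine Finset.sum_congr rfl fun p hp => ?_
    rw [← Finset.HasAntidiagonal.mem_antidiagonal.1 hp]
    push_cast
    module
  have h2 : (n * lam) • onePowerComul lam n =
      ∑ p ∈ Finset.HasAntidiagonal.antidiagonal n, (p.1 * lam) • onePower lam p.1 ⊗ₜ[k] onePower lam p.2 +
      ∑ p ∈ Finset.HasAntidiagonal.antidiagonal n, (p.2 * lam) • onePower lam p.1 ⊗ₜ[k] onePower lam p.2 := by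
    rw [onePowerComul, Finset.smul_sum, ← Finset.sum_add_distrib]
    refine Finset.sum_congr rfl fun p hp => ?_
    rw [← Finset.HasAntidiagonal.mem_antidiagonal.1 hp]
    push_cast
    module
  -- The two boundary terms on the antidiagonal of n + 1 carry the coefficient 0; without them all
  -- sums run over the antidiagonal of n.
  rw [h1, h2, Finset.Nat.sum_antidiagonal_succ, Finset.Nat.sum_antidiagonal_succ', onePowerComul,
    Finset.mul_sum]
  simp only [Nat.cast_zero, zero_smul, zero_add, ← Finset.sum_add_distrib]
  refine Finset.sum_congr rfl fun p _ => ?_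
  rw [add_mul, Algebra.TensorProduct.tmul_mul_tmul, Algebra.TensorProduct.tmul_mul_tmul, one_mul,
    one_mul, onePower_one_mul, onePower_one_mul, TensorProduct.add_tmul, TensorProduct.tmul_add,
    TensorProduct.tmul_smul, TensorProduct.tmul_smul, ← TensorProduct.smul_tmul',
    ← TensorProduct.smul_tmul']
  abel

theorem baseComul_eq_sum (n : ℕ) : baseComul lam (onePower lam n) =
    ∑ j ∈ Finset.range (n + 1), (-lam) ^ j • onePowerComul lam (n - j) := by
  rw [baseComul_onePower]
  refine Finset.sum_congr rfl fun j _ => ?_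
  rw [onePowerComul, Finset.Nat.sum_antidiagonal_eq_sum_range_succ_mk, Finset.smul_sum]

theorem baseComul_zero : baseComul lam 1 = 1 := by
  have := baseComul_eq_sum lam 0
  simpa [onePowerComul, onePower_zero, Algebra.TensorProduct.one_def] using this

/-- In generating functions, Δ is D divided by 1 + λt; multiplying back by 1 + λt cancels everything
except the term j = 0. -/
theorem onePowerComul_succ (n : ℕ) : onePowerComul lam (n + 1) =
    baseComul lam (onePower lam (n + 1)) + lam • baseComul lam (onePower lam n) := by
  rw [baseComul_eq_sum, baseComul_eq_sum, Finset.sum_range_succ', Finset.smul_sum, add_right_comm,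
    ← Finset.sum_add_distrib, Finset.sum_eq_zero]
  · simp
  · intro j _
    rw [Nat.add_sub_add_right]
    module

/-- Equivalently, a_1 - λ is primitive. -/
theorem baseComul_one : baseComul lam (onePower lam 1) =
    onePower lam 1 ⊗ₜ[k] 1 + 1 ⊗ₜ[k] onePower lam 1 - lam • 1 := by
  have := onePowerComul_succ lam 0
  rw [onePower_zero, baseComul_zero] at this
  rw [eq_sub_iff_add_eq, ← this, onePowerComul, zero_add, Finset.Nat.antidiagonal_succ]
  simp [onePower_zero, add_comm]

/-- Multiplicativity is needed only against a_1, since a_1 will generate the algebra. -/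
theorem baseComul_one_mul (b : ShPlus k k lam) : baseComul lam (onePower lam 1 * b) =
    baseComul lam (onePower lam 1) * baseComul lam b := by
  have key : baseComul lam ∘ₗ LinearMap.mulLeft k (onePower lam 1) =
      LinearMap.mulLeft k (baseComul lam (onePower lam 1)) ∘ₗ baseComul lam := by
    refine hom_ext_onePower fun n => ?_
    simp only [LinearMap.comp_apply, LinearMap.mulLeft_apply]
    induction n with
    | zero => rw [onePower_zero, baseComul_zero, mul_one, mul_one]
    | succ n ih =>
      -- Trading Δ(a_(n+1)) for D_(n+1) reduces the claim to the recursion for D and the induction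
      -- hypothesis for Δ(a_n).
      have hD : baseComul lam (onePower lam (n + 1)) =
          onePowerComul lam (n + 1) - lam • baseComul lam (onePower lam n) := by
        rw [onePowerComul_succ, add_sub_cancel_right]
      rw [hD, mul_sub, mul_smul_comm, ← ih, onePower_one_mul, onePower_one_mul, baseComul_one,
        sub_mul, mul_onePowerComul, onePowerComul_succ, onePowerComul_succ, smul_one_mul]
      simp only [map_add, map_smul]
      push_cast
      module
  exact LinearMap.congr_fun key b

theorem baseCounit_zero : baseCounit lam 1 = 1 := by
  simpa [onePower_zero] using baseCounit_onePower lam 0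

theorem baseCounit_one : baseCounit lam (onePower lam 1) = lam := by
  simpa using baseCounit_onePower lam 1

theorem baseCounit_one_mul (b : ShPlus k k lam) : baseCounit lam (onePower lam 1 * b) =
    baseCounit lam (onePower lam 1) * baseCounit lam b := by
  have key : baseCounit lam ∘ₗ LinearMap.mulLeft k (onePower lam 1) =
      LinearMap.mulLeft k (baseCounit lam (onePower lam 1)) ∘ₗ baseCounit lam := by
    refine hom_ext_onePower fun n => ?_
    simp only [LinearMap.comp_apply, LinearMap.mulLeft_apply]
    rw [onePower_one_mul, map_add, map_smul, map_smul, baseCounit_onePower, baseCounit_onePower,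
      baseCounit_onePower]
    rcases n with _ | _ | n <;> simp
  exact LinearMap.congr_fun key b

end CommRing

variable {k : Type*} [Field k] [CharZero k] (lam : k)

/-- In characteristic zero n + 1 is invertible, so a_1 a_n determines a_(n+1) from a_1 and a_n. -/
theorem adjoin_onePower_one : Algebra.adjoin k {onePower lam 1} = ⊤ := by
  have h : ∀ n, onePower lam n ∈ Algebra.adjoin k {onePower lam 1} := by
    intro n
    induction n with
    | zero => exact one_mem _
    | succ n ih =>
      have h0 : ((n + 1 : ℕ) : k) ≠ 0 := Nat.cast_ne_zero.2 n.succ_ne_zero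
      have h1 : onePower lam (n + 1) = ((n + 1 : ℕ) : k)⁻¹ •
          (onePower lam 1 * onePower lam n - (n * lam) • onePower lam n) := by
        rw [onePower_one_mul, add_sub_cancel_right, inv_smul_smul₀ h0]
      rw [h1]
      exact Subalgebra.smul_mem _ (sub_mem (mul_mem (Algebra.self_mem_adjoin_singleton _ _) ih)
        (Subalgebra.smul_mem _ ih _)) _
  have h2 : (Algebra.adjoin k {onePower lam 1}).toSubmodule.mkQ = 0 :=
    hom_ext_onePower fun n => (Submodule.Quotient.mk_eq_zero _).2 (h n)
  rw [eq_top_iff]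
  intro x _
  exact (Submodule.Quotient.mk_eq_zero _).1 (LinearMap.congr_fun h2 x)

/-- The comultiplication of `Ш⁺(k)` as a homomorphism of algebras. -/
def baseComulAlgHom : ShPlus k k lam →ₐ[k] ShPlus k k lam ⊗[k] ShPlus k k lam :=
  algHomOfAdjoin (adjoin_onePower_one lam) (baseComul lam) (baseComul_zero lam) fun _ ha b => by
    rw [Set.mem_singleton_iff.1 ha, baseComul_one_mul]

/-- The counit of `Ш⁺(k)` as a homomorphism of algebras. -/
def baseCounitAlgHom : ShPlus k k lam →ₐ[k] k :=
  algHomOfAdjoin (adjoin_onePower_one lam) (baseCounit lam) (baseCounit_zero lam) fun _ ha b => by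
    rw [Set.mem_singleton_iff.1 ha, baseCounit_one_mul]

/-- The value of the antipode of `Ш⁺(k)` at `1_k^{⊗ n}`. -/
def baseAntipodeAux : ℕ → ShPlus k k lam
  | 0 => 1
  -- From (n + 1) a_(n+1) = (a_1 - nλ) a_n and the value 2λ - a_1 forced at a_1 by the primitivity
  -- of a_1 - λ.
  | n + 1 => ((n + 1 : ℕ) : k)⁻¹ •
      (((2 * lam - n * lam) • 1 - onePower lam 1) * baseAntipodeAux n)

/-- The antipode of `Ш⁺(k)` as a linear map. -/
def baseAntipode : ShPlus k k lam →ₗ[k] ShPlus k k lam :=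
  (ShPlus.wordBasis lam (Module.Basis.singleton Unit k)).constr k fun w =>
    baseAntipodeAux lam w.length

theorem baseAntipode_onePower (n : ℕ) :
    baseAntipode lam (onePower lam n) = baseAntipodeAux lam n := by
  have h : (FreeMonoid.ofList (List.replicate n ())).length = n := by simp [FreeMonoid.length]
  rw [← wordBasis_onePower, baseAntipode, Module.Basis.constr_basis, h]

theorem baseAntipode_zero : baseAntipode lam 1 = 1 := baseAntipode_onePower lam 0

theorem baseAntipode_one : baseAntipode lam (onePower lam 1) = (2 * lam) • 1 - onePower lam 1 := by
  simp [baseAntipode_onePower, baseAntipodeAux]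

theorem baseAntipode_one_mul (b : ShPlus k k lam) : baseAntipode lam (onePower lam 1 * b) =
    baseAntipode lam (onePower lam 1) * baseAntipode lam b := by
  have key : baseAntipode lam ∘ₗ LinearMap.mulLeft k (onePower lam 1) =
      LinearMap.mulLeft k (baseAntipode lam (onePower lam 1)) ∘ₗ baseAntipode lam := by
    refine hom_ext_onePower fun n => ?_
    have h0 : ((n + 1 : ℕ) : k) ≠ 0 := Nat.cast_ne_zero.2 n.succ_ne_zero
    simp only [LinearMap.comp_apply, LinearMap.mulLeft_apply]
    rw [onePower_one_mul, map_add, map_smul, map_smul, baseAntipode_one, baseAntipode_onePower,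
      baseAntipode_onePower, baseAntipodeAux, smul_inv_smul₀ h0, sub_mul, sub_mul, smul_one_mul,
      smul_one_mul]
    module
  exact LinearMap.congr_fun key b

/-- The antipode of `Ш⁺(k)` as a homomorphism of algebras. -/
def baseAntipodeAlgHom : ShPlus k k lam →ₐ[k] ShPlus k k lam :=
  algHomOfAdjoin (adjoin_onePower_one lam) (baseAntipode lam) (baseAntipode_zero lam)
    fun _ ha b => by rw [Set.mem_singleton_iff.1 ha, baseAntipode_one_mul]

theorem baseComulAlgHom_one : baseComulAlgHom lam (onePower lam 1) =
    onePower lam 1 ⊗ₜ[k] 1 + 1 ⊗ₜ[k] onePower lam 1 - lam • 1 := baseComul_one lam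

theorem baseCounitAlgHom_one : baseCounitAlgHom lam (onePower lam 1) = lam := baseCounit_one lam

theorem baseAntipodeAlgHom_one : baseAntipodeAlgHom lam (onePower lam 1) =
    (2 * lam) • 1 - onePower lam 1 := baseAntipode_one lam

variable {lam} in
theorem algHom_ext_onePower {S : Type*} [CommRing S] [Algebra k S] {f g : ShPlus k k lam →ₐ[k] S}
    (h : f (onePower lam 1) = g (onePower lam 1)) : f = g :=
  AlgHom.ext_of_adjoin_eq_top (adjoin_onePower_one lam) fun _ hx => by
    rw [Set.mem_singleton_iff.1 hx, h]

/-- The Hopf algebra structure of `Ш⁺(k)`. -/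
def baseHopf : HopfStructure k (ShPlus k k lam) where
  comul := baseComulAlgHom lam
  counit := baseCounitAlgHom lam
  antipode := baseAntipode lam
  coassoc := by
    -- Each axiom is an equality of algebra homomorphisms out of `Ш⁺(k)`, so it suffices to compare
    -- values at a_1. For the antipode axioms this uses commutativity: multiplication and antipode
    -- are then algebra homomorphisms.
    have : ((Algebra.TensorProduct.assoc k k k _ _ _).toAlgHom.comp
        (Algebra.TensorProduct.map (baseComulAlgHom lam) (AlgHom.id k _))).comp
          (baseComulAlgHom lam) =
        (Algebra.TensorProduct.map (AlgHom.id k _) (baseComulAlgHom lam)).comp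
          (baseComulAlgHom lam) := by
      apply algHom_ext_onePower
      simp [baseComulAlgHom_one, TensorProduct.add_tmul, TensorProduct.tmul_add,
        TensorProduct.sub_tmul, TensorProduct.tmul_sub, Algebra.TensorProduct.one_def,
        ← TensorProduct.smul_tmul']
      abel
    exact congrArg AlgHom.toLinearMap this
  rTensor_counit_comp_comul := by
    have : (Algebra.TensorProduct.map (baseCounitAlgHom lam) (AlgHom.id k _)).comp
        (baseComulAlgHom lam) = Algebra.TensorProduct.includeRight := by
      apply algHom_ext_onePower
      simp [baseComulAlgHom_one, baseCounitAlgHom_one, Algebra.TensorProduct.one_def,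
        TensorProduct.smul_tmul']
    exact congrArg AlgHom.toLinearMap this
  lTensor_counit_comp_comul := by
    have : (Algebra.TensorProduct.map (AlgHom.id k _) (baseCounitAlgHom lam)).comp
        (baseComulAlgHom lam) = Algebra.TensorProduct.includeLeft := by
      apply algHom_ext_onePower
      simp [baseComulAlgHom_one, baseCounitAlgHom_one, Algebra.TensorProduct.one_def,
        ← TensorProduct.tmul_smul]
    exact congrArg AlgHom.toLinearMap this
  mul_antipode_rTensor_comul := by
    have : ((Algebra.TensorProduct.lmul' k).comp
        (Algebra.TensorProduct.map (baseAntipodeAlgHom lam) (AlgHom.id k _))).comp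
        (baseComulAlgHom lam) = (Algebra.ofId k _).comp (baseCounitAlgHom lam) := by
      apply algHom_ext_onePower
      simp [baseComulAlgHom_one, baseCounitAlgHom_one, baseAntipodeAlgHom_one,
        Algebra.ofId_apply, Algebra.algebraMap_eq_smul_one]
      module
    exact congrArg AlgHom.toLinearMap this
  mul_antipode_lTensor_comul := by
    have : ((Algebra.TensorProduct.lmul' k).comp
        (Algebra.TensorProduct.map (AlgHom.id k _) (baseAntipodeAlgHom lam))).comp
        (baseComulAlgHom lam) = (Algebra.ofId k _).comp (baseCounitAlgHom lam) := by
      apply algHom_ext_onePower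
      simp [baseComulAlgHom_one, baseCounitAlgHom_one, baseAntipodeAlgHom_one,
        Algebra.ofId_apply, Algebra.algebraMap_eq_smul_one]
      module
    exact congrArg AlgHom.toLinearMap this

end Base

/-! ### Tensor products and transport of Hopf structures. -/

namespace HopfStructure

variable {k : Type*} [CommRing k] {H : Type*} [Ring H] [Algebra k H]
  {H' : Type*} [Ring H'] [Algebra k H']

/-- The tensor product of two Hopf algebra structures. -/
def tensor (S : HopfStructure k H) (S' : HopfStructure k H') : HopfStructure k (H ⊗[k] H') :=
  let := S.toHopfAlgebra
  let := S'.toHopfAlgebra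
  { comul := Bialgebra.comulAlgHom k (H ⊗[k] H')
    counit := Bialgebra.counitAlgHom k (H ⊗[k] H')
    antipode := HopfAlgebra.antipode k
    coassoc := Coalgebra.coassoc
    rTensor_counit_comp_comul := Coalgebra.rTensor_counit_comp_comul
    lTensor_counit_comp_comul := Coalgebra.lTensor_counit_comp_comul
    mul_antipode_rTensor_comul := HopfAlgebra.mul_antipode_rTensor_comul
    mul_antipode_lTensor_comul := HopfAlgebra.mul_antipode_lTensor_comul }

theorem comul_apply_one (S : HopfStructure k H) : S.comul 1 = 1 ⊗ₜ 1 := by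
  rw [map_one, Algebra.TensorProduct.one_def]

theorem antipode_apply_one (S : HopfStructure k H) : S.antipode 1 = 1 := by
  let := S.toHopfAlgebra
  exact HopfAlgebra.antipode_one (R := k) (A := H)

/-- The structure maps of the tensor product act factorwise and those of the second factor fix its
unit, so that factor contributes only 1. -/
theorem isHopfHom_includeLeft (S : HopfStructure k H) (S' : HopfStructure k H') :
    IsHopfHom S (S.tensor S') Algebra.TensorProduct.includeLeft where
  map_comul x := by
    change TensorProduct.AlgebraTensorModule.tensorTensorTensorComm k k k k H H H' H'
      (S.comul x ⊗ₜ S'.comul 1) = _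
    rw [S'.comul_apply_one]
    generalize S.comul x = z
    induction z with
    | zero => simp
    | add a b ha hb => simp only [TensorProduct.add_tmul, map_add, ha, hb]
    | tmul a b => simp
  map_counit x := by
    change TensorProduct.rid k k (S.counit x ⊗ₜ S'.counit 1) = _
    simp
  map_antipode x := by
    change S.antipode x ⊗ₜ S'.antipode 1 = _
    rw [S'.antipode_apply_one]
    rfl

theorem isHopfHom_includeRight (S : HopfStructure k H) (S' : HopfStructure k H') :
    IsHopfHom S' (S.tensor S') Algebra.TensorProduct.includeRight where
  map_comul x := by
    change TensorProduct.AlgebraTensorModule.tensorTensorTensorComm k k k k H H H' H'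
      (S.comul 1 ⊗ₜ S'.comul x) = _
    rw [S.comul_apply_one]
    generalize S'.comul x = z
    induction z with
    | zero => simp
    | add a b ha hb => simp only [TensorProduct.tmul_add, map_add, ha, hb]
    | tmul a b => simp
  map_counit x := by
    change TensorProduct.rid k k (S.counit 1 ⊗ₜ S'.counit x) = _
    simp
  map_antipode x := by
    change S.antipode 1 ⊗ₜ S'.antipode x = _
    rw [S.antipode_apply_one]
    rfl

/-- The transport of a Hopf algebra structure along an isomorphism of algebras. -/
def congr (S : HopfStructure k H) (e : H ≃ₐ[k] H') : HopfStructure k H' where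
  comul := (Algebra.TensorProduct.map e.toAlgHom e.toAlgHom).comp (S.comul.comp e.symm.toAlgHom)
  counit := S.counit.comp e.symm.toAlgHom
  antipode := e.toLinearMap ∘ₗ S.antipode ∘ₗ e.symm.toLinearMap
  coassoc := by
    ext y
    obtain ⟨x, rfl⟩ := e.surjective y
    -- Each axiom for H' at e x is the image under tensor powers of e of the axiom for H at x;
    -- additivity reduces the comparison to pure tensors.
    have h := congrArg (TensorProduct.map e.toLinearMap (TensorProduct.map e.toLinearMap
      e.toLinearMap)) (LinearMap.congr_fun S.coassoc x)
    simp only [LinearMap.comp_apply, LinearEquiv.coe_coe, AlgHom.toLinearMap_apply,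
      AlgHom.comp_apply, AlgEquiv.toAlgHom_apply, AlgEquiv.symm_apply_apply] at h ⊢
    generalize S.comul x = z at h ⊢
    refine Eq.trans ?_ (h.trans ?_)
    · clear h
      induction z with
      | zero => simp
      | add a b ha hb => simp only [map_add, ha, hb]
      | tmul a b =>
        simp
        generalize S.comul a = z
        induction z with
        | zero => simp
        | add a b ha hb => simp only [TensorProduct.add_tmul, map_add, ha, hb]
        | tmul a b => simp
    · clear h
      induction z with
      | zero => simp
      | add a b ha hb => simp only [map_add, ha, hb]
      | tmul a b => simp; rfl
  rTensor_counit_comp_comul := by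
    ext y
    obtain ⟨x, rfl⟩ := e.surjective y
    have h := congrArg (e.toLinearMap.lTensor k) (LinearMap.congr_fun S.rTensor_counit_comp_comul x)
    simp only [LinearMap.comp_apply, AlgHom.toLinearMap_apply,
      AlgHom.comp_apply, AlgEquiv.toAlgHom_apply, AlgEquiv.symm_apply_apply] at h ⊢
    refine Eq.trans ?_ (h.trans (by simp))
    clear h
    generalize S.comul x = z
    induction z with
    | zero => simp
    | add a b ha hb => simp only [map_add, ha, hb]
    | tmul a b => simp
  lTensor_counit_comp_comul := by
    ext y
    obtain ⟨x, rfl⟩ := e.surjective y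
    have h := congrArg (e.toLinearMap.rTensor k) (LinearMap.congr_fun S.lTensor_counit_comp_comul x)
    simp only [LinearMap.comp_apply, AlgHom.toLinearMap_apply,
      AlgHom.comp_apply, AlgEquiv.toAlgHom_apply, AlgEquiv.symm_apply_apply] at h ⊢
    refine Eq.trans ?_ (h.trans (by simp))
    clear h
    generalize S.comul x = z
    induction z with
    | zero => simp
    | add a b ha hb => simp only [map_add, ha, hb]
    | tmul a b => simp
  mul_antipode_rTensor_comul := by
    ext y
    obtain ⟨x, rfl⟩ := e.surjective y
    have h := congrArg e (LinearMap.congr_fun S.mul_antipode_rTensor_comul x)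
    simp only [LinearMap.comp_apply, AlgHom.toLinearMap_apply,
      AlgHom.comp_apply, AlgEquiv.toAlgHom_apply, AlgEquiv.symm_apply_apply] at h ⊢
    refine Eq.trans ?_ (h.trans (by simp))
    clear h
    generalize S.comul x = z
    induction z with
    | zero => simp
    | add a b ha hb => simp only [map_add, ha, hb]
    | tmul a b => simp
  mul_antipode_lTensor_comul := by
    ext y
    obtain ⟨x, rfl⟩ := e.surjective y
    have h := congrArg e (LinearMap.congr_fun S.mul_antipode_lTensor_comul x)
    simp only [LinearMap.comp_apply, AlgHom.toLinearMap_apply,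
      AlgHom.comp_apply, AlgEquiv.toAlgHom_apply, AlgEquiv.symm_apply_apply] at h ⊢
    refine Eq.trans ?_ (h.trans (by simp))
    clear h
    generalize S.comul x = z
    induction z with
    | zero => simp
    | add a b ha hb => simp only [map_add, ha, hb]
    | tmul a b => simp

theorem isHopfHom_congr (S : HopfStructure k H) (e : H ≃ₐ[k] H') :
    IsHopfHom S (S.congr e) e.toAlgHom where
  map_comul x := by simp [congr]
  map_counit x := by simp [congr]
  map_antipode x := by simp [congr]

end HopfStructure

theorem IsHopfHom.comp {k : Type*} [CommRing k] {H₁ H₂ H₃ : Type*} [Ring H₁] [Algebra k H₁]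
    [Ring H₂] [Algebra k H₂] [Ring H₃] [Algebra k H₃] {S₁ : HopfStructure k H₁}
    {S₂ : HopfStructure k H₂} {S₃ : HopfStructure k H₃} {g : H₂ →ₐ[k] H₃} {f : H₁ →ₐ[k] H₂}
    (hg : IsHopfHom S₂ S₃ g) (hf : IsHopfHom S₁ S₂ f) : IsHopfHom S₁ S₃ (g.comp f) where
  map_comul x := by
    rw [Algebra.TensorProduct.map_comp, AlgHom.comp_apply, hg.map_comul, hf.map_comul]
    rfl
  map_counit x := by rw [AlgHom.comp_apply, hg.map_counit, hf.map_counit]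
  map_antipode x := by simp only [AlgHom.comp_apply, hg.map_antipode, hf.map_antipode]

/-! ### One-shuffled elements and their first-letter recursion. -/

section OneShuffled

variable (k : Type*) [CommRing k] (X : Type*) [HoffmanSet X] (lam : k)

/-- The basis `{1_Ã} ∪ X` of `Ã`. -/
def extendedBasis : Module.Basis (Option X) k (HoffmanUnitalAlgebra k X) :=
  (((Module.Basis.singleton Unit k).prod (HoffmanAlgebra.basis k X)).map
    (Unitization.linearEquiv k k (HoffmanAlgebra k X)).symm).reindex
    ((Equiv.sumComm _ _).trans (Equiv.optionEquivSumPUnit X).symm)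

theorem extendedBasis_apply (x : Option X) : extendedBasis k X x = extendedLetter k x := by
  rcases x with _ | x
  · simp only [extendedBasis, Module.Basis.reindex_apply, Module.Basis.map_apply]
    simp [extendedLetter]
    rfl
  · simp only [extendedBasis, Module.Basis.reindex_apply, Module.Basis.map_apply]
    simp [extendedLetter]
    rfl

theorem extendedWord_eq_wordBasis (v : List (Option X)) :
    extendedWord k lam v = ShPlus.wordBasis lam (extendedBasis k X) (FreeMonoid.ofList v) := by
  rw [ShPlus.wordBasis_apply, extendedWord, funext (extendedBasis_apply k X)]
  rfl

variable {X}

theorem extendedWord_cons (x : Option X) (v : List (Option X)) :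
    extendedWord k lam (x :: v) = ShPlus.cons lam (extendedLetter k x) (extendedWord k lam v) := by
  rw [extendedWord, List.map_cons, ShPlus.word_cons, extendedWord]

/-- The sum of the words of length `n` in the letters of `X̃` with the subsequence `l` of letters
different from `1_Ã`. -/
def interleavings (n : ℕ) (l : List X) : ShPlus k (HoffmanUnitalAlgebra k X) lam :=
  ∑ v ∈ (finite_rearrangements_aux n l).toFinset, extendedWord k lam v

theorem oneShuffled_eq_interleavings (w : List (Option X)) :
    oneShuffled k lam w = interleavings k lam w.length w.reduceOption := rfl

theorem interleavings_of_lt {n : ℕ} {l : List X} (h : n < l.length) :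
    interleavings k lam n l = 0 := by
  refine Finset.sum_eq_zero fun v hv => ?_
  obtain ⟨h1, rfl⟩ := (Set.Finite.mem_toFinset _).1 hv
  have := List.reduceOption_length_le v
  omega

theorem interleavings_zero_nil : interleavings k lam 0 ([] : List X) = 1 := by
  have h : (finite_rearrangements_aux 0 ([] : List X)).toFinset = {[]} := by
    ext v
    simp only [Set.Finite.mem_toFinset, Set.mem_ofPred_eq, Finset.mem_singleton,
      List.length_eq_zero_iff]
    exact ⟨And.left, fun h => ⟨h, by rw [h]; rfl⟩⟩
  rw [interleavings, h, Finset.sum_singleton]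
  rfl

theorem interleavings_succ_nil (n : ℕ) : interleavings k lam (n + 1) ([] : List X) =
    ShPlus.cons lam 1 (interleavings k lam n ([] : List X)) := by
  rw [interleavings, interleavings, map_sum]
  symm
  refine Finset.sum_bij (fun v _ => none :: v) ?_ ?_ ?_ ?_
  · intro v hv
    simpa using hv
  · intro v _ w _ h
    exact (List.cons.inj h).2
  · intro v hv
    rw [Set.Finite.mem_toFinset] at hv
    rcases v with _ | ⟨_ | x, v⟩
    · simp at hv
    · exact ⟨v, by simpa using hv, rfl⟩
    · simp [List.reduceOption_cons_of_some] at hv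
  · intro v _
    rw [extendedWord_cons]
    rfl

open scoped Classical in
-- Words are sorted by their first letter, which is either the unit or the first letter of the
-- prescribed subsequence.
theorem interleavings_succ_cons (n : ℕ) (x : X) (l : List X) :
    interleavings k lam (n + 1) (x :: l) =
      ShPlus.cons lam 1 (interleavings k lam n (x :: l)) +
      ShPlus.cons lam (extendedLetter k (some x)) (interleavings k lam n l) := by
  have h : (finite_rearrangements_aux (n + 1) (x :: l)).toFinset =
      (finite_rearrangements_aux n (x :: l)).toFinset.image (List.cons none) ∪
      (finite_rearrangements_aux n l).toFinset.image (List.cons (some x)) := by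
    ext v
    simp only [Finset.mem_union, Finset.mem_image, Set.Finite.mem_toFinset, Set.mem_ofPred_eq]
    constructor
    · rintro ⟨h1, h2⟩
      rcases v with _ | ⟨_ | y, v⟩
      · simp at h1
      · exact Or.inl ⟨v, ⟨by simpa using h1, by simpa using h2⟩, rfl⟩
      · rw [List.reduceOption_cons_of_some, List.cons.injEq] at h2
        obtain ⟨rfl, h2⟩ := h2
        exact Or.inr ⟨v, ⟨by simpa using h1, h2⟩, rfl⟩
    · rintro (⟨v, ⟨h1, h2⟩, rfl⟩ | ⟨v, ⟨h1, h2⟩, rfl⟩)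
      · simp [h1, h2]
      · simp [h1, h2, List.reduceOption_cons_of_some]
  rw [interleavings, h, Finset.sum_union, Finset.sum_image (fun v _ w _ h => (List.cons.inj h).2),
    Finset.sum_image (fun v _ w _ h => (List.cons.inj h).2), interleavings, interleavings, map_sum,
    map_sum]
  · simp only [extendedWord_cons]
    rfl
  · rw [Finset.disjoint_left]
    intro v hv hv'
    obtain ⟨w, -, rfl⟩ := Finset.mem_image.1 hv
    obtain ⟨w', -, h'⟩ := Finset.mem_image.1 hv'
    simp at h'

/-! ### The lowering operator and the twist. -/

variable {k}

/-- The linear map `Ш⁺(k) → Ш⁺(k)` that sends `1_k^{⊗ (n + 1)}` to `1_k^{⊗ n}` and `1` to `0`. -/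
def lower : Module.End k (ShPlus k k lam) :=
  (ShPlus.wordBasis lam (Module.Basis.singleton Unit k)).constr k fun w =>
    if w.length = 0 then 0 else onePower lam (w.length - 1)

theorem lower_onePower (n : ℕ) :
    lower lam (onePower lam n) = if n = 0 then 0 else onePower lam (n - 1) := by
  have h : (FreeMonoid.ofList (List.replicate n ())).length = n := by simp [FreeMonoid.length]
  rw [← wordBasis_onePower, lower, Module.Basis.constr_basis, h]

theorem lower_zero : lower lam 1 = 0 := by simpa [onePower_zero] using lower_onePower lam 0

theorem lower_succ (n : ℕ) : lower lam (onePower lam (n + 1)) = onePower lam n := by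
  simpa using lower_onePower lam (n + 1)

/-- The value at `1_k^{⊗ n}` of the inverse of `1 + λ • lower`. -/
def oneAddLowerInvAux : ℕ → ShPlus k k lam
  | 0 => 1
  -- Apply the inverse to (1 + λ • lower) a_(n+1) = a_(n+1) + λ a_n.
  | n + 1 => onePower lam (n + 1) - lam • oneAddLowerInvAux n

/-- The inverse of `1 + λ • lower`. -/
def oneAddLowerInv : Module.End k (ShPlus k k lam) :=
  (ShPlus.wordBasis lam (Module.Basis.singleton Unit k)).constr k fun w =>
    oneAddLowerInvAux lam w.length

theorem oneAddLowerInv_onePower (n : ℕ) :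
    oneAddLowerInv lam (onePower lam n) = oneAddLowerInvAux lam n := by
  have h : (FreeMonoid.ofList (List.replicate n ())).length = n := by simp [FreeMonoid.length]
  rw [← wordBasis_onePower, oneAddLowerInv, Module.Basis.constr_basis, h]

theorem oneAddLower_mul_inv : (1 + lam • lower lam) * oneAddLowerInv lam = 1 := by
  refine hom_ext_onePower fun n => ?_
  rw [Module.End.mul_apply, oneAddLowerInv_onePower, Module.End.one_apply]
  induction n with
  | zero => simp [oneAddLowerInvAux, lower_zero, onePower_zero]
  | succ n ih => simp [oneAddLowerInvAux, lower_succ, ← ih]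

theorem inv_mul_oneAddLower : oneAddLowerInv lam * (1 + lam • lower lam) = 1 := by
  refine hom_ext_onePower fun n => ?_
  rw [Module.End.mul_apply, Module.End.one_apply]
  cases n with
  | zero =>
    simpa [onePower_zero, lower_zero, oneAddLowerInvAux] using oneAddLowerInv_onePower lam 0
  | succ n => simp [oneAddLowerInvAux, lower_succ, oneAddLowerInv_onePower]

variable (X)

/-- The endomorphism `b ⊗ w ↦ f ^ |w| b ⊗ w` of `Ш⁺(k) ⊗ Ш⁺(A)`. -/
def twist (f : Module.End k (ShPlus k k lam)) :
    Module.End k (ShPlus k k lam ⊗[k] ShPlus k (HoffmanAlgebra k X) lam) :=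
  TensorProduct.lift (((ShPlus.wordBasis lam (HoffmanAlgebra.basis k X)).constr k fun w =>
    (TensorProduct.mk k _ _).flip (ShPlus.wordBasis lam (HoffmanAlgebra.basis k X) w) ∘ₗ
      f ^ w.length).flip)

variable {X}

theorem twist_tmul_word (f : Module.End k (ShPlus k k lam)) (b : ShPlus k k lam) (l : List X) :
    twist X lam f (b ⊗ₜ ShPlus.word k lam (l.map (HoffmanAlgebra.basis k X))) =
      (f ^ l.length) b ⊗ₜ ShPlus.word k lam (l.map (HoffmanAlgebra.basis k X)) := by
  have hl : ShPlus.wordBasis lam (HoffmanAlgebra.basis k X) (FreeMonoid.ofList l) =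
      ShPlus.word k lam (l.map (HoffmanAlgebra.basis k X)) := ShPlus.wordBasis_apply _ _ _
  rw [← hl, twist, TensorProduct.lift.tmul, LinearMap.flip_apply, Module.Basis.constr_basis]
  rfl

theorem hom_ext_tmul_word {M : Type*} [AddCommMonoid M] [Module k M]
    {f g : ShPlus k k lam ⊗[k] ShPlus k (HoffmanAlgebra k X) lam →ₗ[k] M}
    (h : ∀ n (l : List X),
      f (onePower lam n ⊗ₜ ShPlus.word k lam (l.map (HoffmanAlgebra.basis k X))) =
      g (onePower lam n ⊗ₜ ShPlus.word k lam (l.map (HoffmanAlgebra.basis k X)))) : f = g := by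
  refine TensorProduct.ext (hom_ext_onePower fun n => hom_ext_basis_word lam fun l => ?_)
  exact h n l

theorem range_le_of_tmul_word {M : Type*} [AddCommMonoid M] [Module k M]
    {f : ShPlus k k lam ⊗[k] ShPlus k (HoffmanAlgebra k X) lam →ₗ[k] M} {S : Submodule k M}
    (h : ∀ n (l : List X),
      f (onePower lam n ⊗ₜ ShPlus.word k lam (l.map (HoffmanAlgebra.basis k X))) ∈ S) :
    LinearMap.range f ≤ S := by
  rw [LinearMap.range_eq_map, Submodule.map_le_iff_le_comap,
    ← ((ShPlus.wordBasis lam (Module.Basis.singleton Unit k)).tensorProduct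
      (ShPlus.wordBasis lam (HoffmanAlgebra.basis k X))).span_eq, Submodule.span_le]
  rintro _ ⟨⟨v, w⟩, rfl⟩
  have hv : v = FreeMonoid.ofList (List.replicate v.length ()) :=
    List.eq_replicate_iff.2 ⟨rfl, fun _ _ => rfl⟩
  rw [Module.Basis.tensorProduct_apply, hv, wordBasis_onePower, ShPlus.wordBasis_apply]
  exact h _ _

theorem twist_comp_twist {f g : Module.End k (ShPlus k k lam)} (hc : g * f = 1) :
    twist X lam g ∘ₗ twist X lam f = LinearMap.id := by
  have h : ∀ n, g ^ n * f ^ n = 1 := fun n => by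
    induction n with
    | zero => simp
    -- The innermost pair g * f cancels, so a one-sided inverse suffices and f and g need not
    -- commute.
    | succ n ih => rw [pow_succ, pow_succ', mul_assoc, ← mul_assoc g f, hc, one_mul, ih]
  refine hom_ext_tmul_word lam fun n l => ?_
  rw [LinearMap.comp_apply, twist_tmul_word, twist_tmul_word, ← Module.End.mul_apply, h]
  rfl

/-- The linear map `Ш⁺(k) → Ш⁺(Ã)` that sends `1_k^{⊗ n}` to the one-shuffled element of the word
of `n` letters `1_Ã` followed by `l`. -/
def shuffleOnes (l : List X) : ShPlus k k lam →ₗ[k] ShPlus k (HoffmanUnitalAlgebra k X) lam :=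
  (ShPlus.wordBasis lam (Module.Basis.singleton Unit k)).constr k fun w =>
    interleavings k lam (w.length + l.length) l

theorem shuffleOnes_onePower (l : List X) (n : ℕ) :
    shuffleOnes lam l (onePower lam n) = interleavings k lam (n + l.length) l := by
  have h : (FreeMonoid.ofList (List.replicate n ())).length = n := by simp [FreeMonoid.length]
  rw [← wordBasis_onePower, shuffleOnes, Module.Basis.constr_basis, h]

theorem shuffleOnes_nil : shuffleOnes lam ([] : List X) = gammaPlus k X lam := by
  refine hom_ext_onePower fun n => ?_
  rw [shuffleOnes_onePower, gammaPlus_onePower, List.length_nil, add_zero]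
  induction n with
  | zero => rw [interleavings_zero_nil]; rfl
  | succ n ih => rw [interleavings_succ_nil, ih, List.replicate_succ, extendedWord_cons]; rfl

/-- Taking away a leading unit lowers the number of units by one, while taking away x leaves it
unchanged. -/
theorem shuffleOnes_cons (x : X) (l : List X) (b : ShPlus k k lam) :
    shuffleOnes lam (x :: l) b = ShPlus.cons lam 1 (shuffleOnes lam (x :: l) (lower lam b)) +
      ShPlus.cons lam (extendedLetter k (some x)) (shuffleOnes lam l b) := by
  have key : shuffleOnes lam (x :: l) =
      ShPlus.cons lam 1 ∘ₗ shuffleOnes lam (x :: l) ∘ₗ lower lam +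
      ShPlus.cons lam (extendedLetter k (some x)) ∘ₗ shuffleOnes lam l := by
    refine hom_ext_onePower fun n => ?_
    simp only [LinearMap.add_apply, LinearMap.comp_apply]
    rw [shuffleOnes_onePower, shuffleOnes_onePower, List.length_cons, ← add_assoc,
      interleavings_succ_cons]
    congr 2
    cases n with
    -- Without units no word can begin with one: the remaining length would be smaller than that of
    -- the prescribed subsequence.
    | zero => rw [onePower_zero, lower_zero, map_zero, interleavings_of_lt k lam (by simp)]
    | succ n =>
      rw [lower_succ, shuffleOnes_onePower, List.length_cons, add_right_comm, add_assoc]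
  exact LinearMap.congr_fun key b

theorem one_mul_extendedLetter (x : X) :
    (1 : HoffmanUnitalAlgebra k X) * extendedLetter k (some x) = extendedLetter k (some x) :=
  one_mul _

/-- A unit merged with a letter disappears at the cost of λ. Each letter of l either absorbs a unit
or does not, and so contributes one factor 1 + λ • `lower`. In the proof both sides satisfy the same
recursion on first letters, by induction on l and then on the number of units. -/
theorem gammaPlus_mul_betaPlus (b : ShPlus k k lam) (l : List X) :
    gammaPlus k X lam b *
      betaPlus k X lam (ShPlus.word k lam (l.map (HoffmanAlgebra.basis k X))) =
      shuffleOnes lam l (((1 + lam • lower lam) ^ l.length) b) := by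
  induction l generalizing b with
  | nil =>
    rw [betaPlus_word, shuffleOnes_nil]
    exact mul_one (gammaPlus k X lam b)
  | cons x l ih =>
    rw [betaPlus_word] at ih ⊢
    -- The recursion for the right-hand side: `lower` commutes with powers of 1 + λ • `lower`, and
    -- one such factor is split off for the letter x.
    have hs : ∀ b, shuffleOnes lam (x :: l) (((1 + lam • lower lam) ^ (l.length + 1)) b) =
        ShPlus.cons lam 1 (shuffleOnes lam (x :: l)
          (((1 + lam • lower lam) ^ (l.length + 1)) (lower lam b))) +
        ShPlus.cons lam (extendedLetter k (some x))
          (gammaPlus k X lam ((1 + lam • lower lam) b) * extendedWord k lam (l.map some)) := by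
      intro b
      have hc : Commute (lower lam) ((1 + lam • lower lam) ^ (l.length + 1)) :=
        ((Commute.one_right _).add_right ((Commute.refl _).smul_right lam)).pow_right _
      rw [shuffleOnes_cons, ← Module.End.mul_apply, hc.eq, Module.End.mul_apply, ih,
        pow_succ, Module.End.mul_apply]
      rfl
    have key : ShPlus.mulRight k lam (extendedWord k lam ((x :: l).map some)) ∘ₗ
        gammaPlus k X lam =
        shuffleOnes lam (x :: l) ∘ₗ (1 + lam • lower lam) ^ (l.length + 1) := by
      refine hom_ext_onePower fun n => ?_
      simp only [LinearMap.comp_apply, ShPlus.mulRight_apply]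
      induction n with
      | zero =>
        rw [hs, onePower_zero, lower_zero, map_zero, map_zero, ShPlus.cons_zero_add,
          LinearMap.add_apply, LinearMap.smul_apply, lower_zero, smul_zero, add_zero,
          Module.End.one_apply]
        have h1 : ∀ w, gammaPlus k X lam 1 * w = w := fun w =>
          (congrArg (· * w) (ShPlus.map_one' _)).trans (one_mul w)
        rw [h1, h1, List.map_cons, extendedWord_cons]
      | succ n ihn =>
        rw [hs, lower_succ, ← ihn, LinearMap.add_apply, LinearMap.smul_apply, lower_succ,
          Module.End.one_apply, List.map_cons, extendedWord_cons, map_add, map_smul, add_mul,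
          map_add, smul_mul_assoc, map_smul]
        have h1 : gammaPlus k X lam (onePower lam (n + 1)) =
            ShPlus.cons lam 1 (gammaPlus k X lam (onePower lam n)) := by
          rw [gammaPlus_onePower, gammaPlus_onePower, List.replicate_succ, extendedWord_cons]
          rfl
        -- The merged term also begins with x; with the term that begins with the unmerged x it
        -- accounts for 1 + λ • `lower`.
        rw [h1, ShPlus.cons_mul_cons, one_mul_extendedLetter, add_assoc]
    exact LinearMap.congr_fun key b

/-! ### One-shuffled elements as a basis of their span. -/

variable (X)

/-- The linear map `Ш⁺(k) ⊗ Ш⁺(A) → Ш⁺(Ã)` that sends `1_k^{⊗ n} ⊗ w` to the one-shuffled element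
of the word of `n` letters `1_Ã` followed by `w`. -/
def shuffleMap : ShPlus k k lam ⊗[k] ShPlus k (HoffmanAlgebra k X) lam →ₗ[k]
    ShPlus k (HoffmanUnitalAlgebra k X) lam :=
  TensorProduct.lift (((ShPlus.wordBasis lam (HoffmanAlgebra.basis k X)).constr k fun w =>
    shuffleOnes lam w.toList).flip)

variable {X}

theorem shuffleMap_tmul_word (b : ShPlus k k lam) (l : List X) :
    shuffleMap X lam (b ⊗ₜ ShPlus.word k lam (l.map (HoffmanAlgebra.basis k X))) =
      shuffleOnes lam l b := by
  have hl : ShPlus.wordBasis lam (HoffmanAlgebra.basis k X) (FreeMonoid.ofList l) =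
      ShPlus.word k lam (l.map (HoffmanAlgebra.basis k X)) := ShPlus.wordBasis_apply _ _ _
  rw [← hl, shuffleMap, TensorProduct.lift.tmul, LinearMap.flip_apply, Module.Basis.constr_basis]
  rfl

variable (X)

open Classical in
/-- A left inverse of `shuffleMap`: it keeps the words all of whose letters `1_Ã` come first. -/
def shuffleMapLeftInv : ShPlus k (HoffmanUnitalAlgebra k X) lam →ₗ[k]
    ShPlus k k lam ⊗[k] ShPlus k (HoffmanAlgebra k X) lam :=
  (ShPlus.wordBasis lam (extendedBasis k X)).constr k fun v =>
    if v.toList = List.replicate (v.toList.length - v.toList.reduceOption.length) none ++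
      v.toList.reduceOption.map some then
      onePower lam (v.toList.length - v.toList.reduceOption.length) ⊗ₜ
        ShPlus.word k lam (v.toList.reduceOption.map (HoffmanAlgebra.basis k X))
    else 0

variable {X}

theorem reduceOption_replicate_append {X : Type*} (n : ℕ) (l : List X) :
    (List.replicate n none ++ l.map some).reduceOption = l := by
  induction n with
  | zero => simp [List.reduceOption]
  | succ n ih => simpa [List.replicate_succ] using ih

/-- Among the words with given length and given subsequence in X, exactly one has all its units in
front, and it determines both the number of units and the subsequence. -/
theorem shuffleMapLeftInv_comp : shuffleMapLeftInv X lam ∘ₗ shuffleMap X lam = LinearMap.id := by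
  classical
  refine hom_ext_tmul_word lam fun n l => ?_
  rw [LinearMap.comp_apply, shuffleMap_tmul_word, shuffleOnes_onePower, interleavings, map_sum]
  trans ∑ v ∈ (finite_rearrangements_aux (n + l.length) l).toFinset,
    if v = List.replicate n none ++ l.map some then
      onePower lam n ⊗ₜ[k] ShPlus.word k lam (l.map (HoffmanAlgebra.basis k X)) else 0
  · refine Finset.sum_congr rfl fun v hv => ?_
    obtain ⟨h1, h2⟩ := (Set.Finite.mem_toFinset _).1 hv
    rw [extendedWord_eq_wordBasis, shuffleMapLeftInv, Module.Basis.constr_basis]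
    have h3 : n = v.length - v.reduceOption.length := by rw [h1, h2, Nat.add_sub_cancel]
    subst h2
    rw [h3]
    congr
  · rw [Finset.sum_ite_eq', if_pos, LinearMap.id_apply]
    rw [Set.Finite.mem_toFinset]
    exact ⟨by simp, reduceOption_replicate_append n l⟩

/-- A one-shuffled element depends only on the length and the subsequence in X, so it is also that
of the word with its units moved to the front. -/
theorem range_shuffleMap : LinearMap.range (shuffleMap X lam) =
    Submodule.span k (Set.range (oneShuffled (X := X) k lam)) := by
  apply le_antisymm
  · refine range_le_of_tmul_word lam fun n l => Submodule.subset_span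
      ⟨List.replicate n none ++ l.map some, ?_⟩
    rw [shuffleMap_tmul_word, shuffleOnes_onePower, oneShuffled_eq_interleavings,
      reduceOption_replicate_append]
    simp
  · rw [Submodule.span_le]
    rintro _ ⟨w, rfl⟩
    refine ⟨onePower lam (w.length - w.reduceOption.length) ⊗ₜ
      ShPlus.word k lam (w.reduceOption.map (HoffmanAlgebra.basis k X)), ?_⟩
    rw [shuffleMap_tmul_word, shuffleOnes_onePower, oneShuffled_eq_interleavings,
      Nat.sub_add_cancel (List.reduceOption_length_le w)]

/-! ### The algebra V as the tensor product of `Ш⁺(k)` and `Ш⁺(A)`. -/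

variable (k X)

/-- The map `γ⁺` as a homomorphism of algebras. -/
def gammaPlusAlgHom : ShPlus k k lam →ₐ[k] ShPlus k (HoffmanUnitalAlgebra k X) lam :=
  ShPlus.mapAlgHom (Algebra.linearMap k (HoffmanUnitalAlgebra k X)) fun a b => by simp

/-- The inclusion `Ш⁺(A) → Ш⁺(Ã)` as a homomorphism of algebras. -/
def betaPlusAlgHom :
    ShPlus k (HoffmanAlgebra k X) lam →ₐ[k] ShPlus k (HoffmanUnitalAlgebra k X) lam :=
  ShPlus.mapAlgHom (Unitization.inrHom k k (HoffmanAlgebra k X)) fun a b =>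
    Unitization.inr_mul k a b

/-- The homomorphism of algebras `Ш⁺(k) ⊗ Ш⁺(A) → Ш⁺(Ã)`, `b ⊗ w ↦ γ⁺ b * β w`. -/
def gammaBeta : ShPlus k k lam ⊗[k] ShPlus k (HoffmanAlgebra k X) lam →ₐ[k]
    ShPlus k (HoffmanUnitalAlgebra k X) lam :=
  Algebra.TensorProduct.productMap (gammaPlusAlgHom k X lam) (betaPlusAlgHom k X lam)

theorem gammaBeta_eq_comp : (gammaBeta k X lam).toLinearMap =
    shuffleMap X lam ∘ₗ twist X lam (1 + lam • lower lam) := by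
  refine hom_ext_tmul_word lam fun n l => ?_
  rw [LinearMap.comp_apply, twist_tmul_word, shuffleMap_tmul_word, ← gammaPlus_mul_betaPlus]
  rfl

/-- In the factorization `gammaBeta_eq_comp` both maps have explicit left inverses. -/
theorem gammaBeta_injective : Function.Injective (gammaBeta k X lam) := by
  have h : Function.LeftInverse
      (twist X lam (oneAddLowerInv lam) ∘ₗ shuffleMapLeftInv X lam) (gammaBeta k X lam) := by
    intro x
    have h1 := LinearMap.congr_fun (gammaBeta_eq_comp k X lam) x
    rw [AlgHom.toLinearMap_apply] at h1
    rw [h1, LinearMap.comp_apply, LinearMap.comp_apply,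
      ← LinearMap.comp_apply (shuffleMapLeftInv X lam), shuffleMapLeftInv_comp, LinearMap.id_apply,
      ← LinearMap.comp_apply, twist_comp_twist lam (inv_mul_oneAddLower lam), LinearMap.id_apply]
  exact h.injective

theorem range_gammaBeta : Subalgebra.toSubmodule (gammaBeta k X lam).range =
    Submodule.span k (Set.range (oneShuffled (X := X) k lam)) := by
  rw [← range_shuffleMap]
  change LinearMap.range (gammaBeta k X lam).toLinearMap = _
  rw [gammaBeta_eq_comp, LinearMap.range_comp_of_range_eq_top]
  rw [LinearMap.range_eq_top]
  -- The inverse on the other side makes the twist surjective, so it does not change the range.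
  have h := twist_comp_twist (X := X) lam (oneAddLower_mul_inv lam)
  exact fun x => ⟨_, LinearMap.congr_fun h x⟩

theorem range_gammaBeta_eq_mul : Subalgebra.toSubmodule (gammaBeta k X lam).range =
    LinearMap.range (gammaPlus k X lam) * LinearMap.range (betaPlus k X lam) := by
  rw [gammaBeta, Algebra.TensorProduct.productMap_range, ← Subalgebra.mul_toSubmodule]
  rfl

end OneShuffled

/-- The counit of the second factor gives a retraction, so no flatness is needed. -/
theorem HopfStructure.includeLeft_injective {k : Type*} [CommRing k] {H H' : Type*} [Ring H]
    [Algebra k H] [Ring H'] [Algebra k H'] (S : HopfStructure k H') :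
    Function.Injective (Algebra.TensorProduct.includeLeft : H →ₐ[k] H ⊗[k] H') := by
  have h : Function.LeftInverse (TensorProduct.rid k H ∘ₗ S.counit.toLinearMap.lTensor H)
      (Algebra.TensorProduct.includeLeft : H →ₐ[k] H ⊗[k] H') := fun x => by simp
  exact h.injective

theorem HopfStructure.includeRight_injective {k : Type*} [CommRing k] {H H' : Type*} [Ring H]
    [Algebra k H] [Ring H'] [Algebra k H'] (S : HopfStructure k H) :
    Function.Injective (Algebra.TensorProduct.includeRight : H' →ₐ[k] H ⊗[k] H') := by
  have h : Function.LeftInverse (TensorProduct.lid k H' ∘ₗ S.counit.toLinearMap.rTensor H')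
      (Algebra.TensorProduct.includeRight : H' →ₐ[k] H ⊗[k] H') := fun x => by simp
  exact h.injective

end MixableShuffle

end

theorem theorem3p6 (k : Subfield ℂ) (X : Type*) [HoffmanSet X] (lam : k) :
    ∃ V : Subalgebra k (ShPlus k (HoffmanUnitalAlgebra k X) lam),
      Subalgebra.toSubmodule V =
        Submodule.span k (Set.range (oneShuffled (X := X) k lam)) ∧
      Subalgebra.toSubmodule V =
        LinearMap.range (gammaPlus k X lam) * LinearMap.range (betaPlus k X lam) ∧
      ∃ (H₁ : HopfStructure k (ShPlus k k lam))
        (H₂ : HopfStructure k (ShPlus k (HoffmanAlgebra k X) lam))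
        (H : HopfStructure k V)
        (g : ShPlus k k lam →ₐ[k] V) (b : ShPlus k (HoffmanAlgebra k X) lam →ₐ[k] V),
        H₁.comul.toLinearMap = baseComul lam ∧ H₁.counit.toLinearMap = baseCounit lam ∧
        H₂.comul.toLinearMap = deconcatenation k X lam ∧
        H₂.counit.toLinearMap = deconcatenationCounit k X lam ∧
        (∀ x, (g x : ShPlus k (HoffmanUnitalAlgebra k X) lam) = gammaPlus k X lam x) ∧
        (∀ x, (b x : ShPlus k (HoffmanUnitalAlgebra k X) lam) = betaPlus k X lam x) ∧
        Function.Injective g ∧ Function.Injective b ∧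
        IsHopfHom H₁ H g ∧ IsHopfHom H₂ H b := by
  -- This isomorphism from `Ш⁺(k) ⊗ Ш⁺(A)` onto V carries the tensor product Hopf structure over; g
  -- and b are the two inclusions of the factors followed by it.
  let e := AlgEquiv.ofInjective (gammaBeta k X lam) (gammaBeta_injective k X lam)
  refine ⟨(gammaBeta k X lam).range, range_gammaBeta k X lam, range_gammaBeta_eq_mul k X lam,
    baseHopf lam, deconcatenationHopf k X lam,
    ((baseHopf lam).tensor (deconcatenationHopf k X lam)).congr e,
    e.toAlgHom.comp Algebra.TensorProduct.includeLeft,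
    e.toAlgHom.comp Algebra.TensorProduct.includeRight, rfl, rfl, rfl, rfl, fun x => ?_,
    fun x => ?_, e.injective.comp (deconcatenationHopf k X lam).includeLeft_injective,
    e.injective.comp (baseHopf lam).includeRight_injective,
    (HopfStructure.isHopfHom_congr _ e).comp (HopfStructure.isHopfHom_includeLeft _ _),
    (HopfStructure.isHopfHom_congr _ e).comp (HopfStructure.isHopfHom_includeRight _ _)⟩
  · exact Algebra.TensorProduct.productMap_left_apply _ _ x
  · exact Algebra.TensorProduct.productMap_right_apply _ _ x
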